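/- Let $\rho=\beta+i\gamma$ denote the non-real zeros of the Riemann zeta-function, counted with multiplicity. For real $\tau$ and $x>0$ put $$\mathcal{R}(x,\tau)=\sum_{0<\gamma<x}\gamma^{-i\tau}-\frac{x^{1-i\tau}}{2\pi(1-i\tau)}\left(\log\frac{x}{2\pi}-\frac{1}{1-i\tau}\right).$$ (i) There is an absolute constant $C$ such that $|\mathcal{R}(x,\tau)|\le C\left(1+|\log x|+|\tau|(\log x)^2\right)$ for all real $\tau$ and all $x>0$. (ii) For every $\delta>0$ there is a constant $C$ depending only on $\delta$ such that $|\mathcal{R}(x,\tau)|\le C\,|\tau|(\log x)^2$ for all real $\tau$ and all $x>0$ with $|\tau\log x|\ge\delta$. (iii) The Lindelöf Hypothesis for the ordinates $\gamma$ holds in the range $|\tau|^2\le x\le|\tau|^B$: for every $\varepsilon>0$ there is a constant $C$ depending only on $\varepsilon$ such that, for every $B>0$ and all real $\tau$ and $x\ge 2$ with $|\tau|^2\le x\le|\tau|^B$, $$\left|\sum_{0<\gamma<x}\gamma^{-i\tau}-\int_2^x\frac{u^{-i\tau}}{2\pi}\log\frac{u}{2\pi}\,du\right|\le C\,|\tau|^{\varepsilon}x^{1/2}.$$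 -/

import Mathlib

/-- The nontrivial (that is, non-real) zeros `ρ = β + iγ` of the Riemann zeta-function whose
ordinate satisfies `0 < γ < x`. -/
def zetaZerosBelow (x : ℝ) : Set ℂ :=
  {ρ : ℂ | riemannZeta ρ = 0 ∧ 0 < ρ.im ∧ ρ.im < x}

theorem zetaZerosBelow_finite (x : ℝ) : (zetaZerosBelow x).Finite := by
  have hK : IsCompact (Set.Icc (0 : ℝ) 1 ×ℂ Set.Icc (0 : ℝ) x) :=
    isCompact_Icc.reProdIm isCompact_Icc
  refine hK.inter_riemannZetaZeros_finite.subset ?_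
  rintro ρ ⟨hz, h0, hx⟩
  have hre1 : ρ.re < 1 := by
    by_contra h
    exact riemannZeta_ne_zero_of_one_le_re (not_lt.mp h) hz
  have hre0 : 0 < ρ.re := by
    by_contra h
    have hne : ρ ≠ 0 := by
      rintro rfl
      simp at h0
    have hne1 : 1 - ρ ≠ 0 := by
      intro h'
      have := congrArg Complex.im h'
      simp at this
      linarith
    have hG : Complex.Gammaℝ ρ ≠ 0 := by
      intro h'
      obtain ⟨n, hn⟩ := Complex.Gammaℝ_eq_zero_iff.mp h'
      have := congrArg Complex.im hn
      simp at this
      linarith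
    have hL : completedRiemannZeta ρ = 0 := by
      have := riemannZeta_def_of_ne_zero hne
      rw [hz] at this
      rcases div_eq_zero_iff.mp this.symm with h1 | h1
      · exact h1
      · exact absurd h1 hG
    have hz' : riemannZeta (1 - ρ) = 0 := by
      rw [riemannZeta_def_of_ne_zero hne1, completedRiemannZeta_one_sub, hL, zero_div]
    refine riemannZeta_ne_zero_of_one_le_re ?_ hz'
    simp only [Complex.sub_re, Complex.one_re]
    linarith [not_lt.mp h]
  refine ⟨?_, hz⟩
  rw [Complex.mem_reProdIm]
  exact ⟨⟨hre0.le, hre1.le⟩, ⟨h0.le, hx.le⟩⟩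

/-- The exponential sum `∑_{0 < γ < x} γ^{-iτ}` over the ordinates of the nontrivial zeros
`ρ = β + iγ` of the Riemann zeta-function, each zero being counted with its multiplicity. -/
noncomputable def zetaOrdinateSum (τ x : ℝ) : ℂ :=
  ∑ ρ ∈ (zetaZerosBelow_finite x).toFinset,
    (analyticOrderNatAt riemannZeta ρ : ℂ) * (ρ.im : ℂ) ^ (-(Complex.I * (τ : ℂ)))

/-- The main term `x^{1-iτ} / (2π(1-iτ)) · (log (x/2π) - 1/(1-iτ))`. -/
noncomputable def ordinateMainTerm (τ x : ℝ) : ℂ :=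
  (x : ℂ) ^ (1 - Complex.I * (τ : ℂ)) / (2 * (Real.pi : ℂ) * (1 - Complex.I * (τ : ℂ))) *
    ((Real.log (x / (2 * Real.pi)) : ℂ) - 1 / (1 - Complex.I * (τ : ℂ)))

/-- The integral `∫_2^x u^{-iτ} / (2π) · log (u/2π) du`. -/
noncomputable def ordinateIntegral (τ x : ℝ) : ℂ :=
  ∫ u in (2 : ℝ)..x, (u : ℂ) ^ (-(Complex.I * (τ : ℂ))) / (2 * (Real.pi : ℂ)) *
    (Real.log (u / (2 * Real.pi)) : ℂ)

open Complex Set MeasureTheory Filter Topology ComplexConjugate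

/-! All three estimates follow from the Riemann–von Mangoldt formula `N(x) = M(x) + O(1 + log x)`
for `x ≥ 1`, where `N` is `zetaCount` and `M` is `zetaCountMain`. Since `M'(u) = log(u/2π)/(2π)`,
the main term of the exponential sum is an antiderivative of `u^{-iτ} M'(u)`. Partial summation then
leaves a boundary term `(N - M)(x) x^{-iτ}`, an integral of `iτ u^{-iτ-1} (N - M)(u)` over `[1, x]`,
and a bounded constant. Taking absolute values gives `O(1 + log x + |τ| (log x)^2)`; no cancellation
is used. In the Lindelöf range `|τ| ≤ x^{1/2}`, so the trivial factor `|τ|` already costs only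
`x^{1/2}`, and `|τ|^ε` pays for the logarithms.

Most of the work is the proof of Riemann–von Mangoldt. The argument principle
(`rectIntegral_logDeriv`) is applied to the entire function `s(s-1)Λ(s)` on `[-1, 2] × [1, T]`. The
functional equation and conjugation fold the left half of the contour onto the right. On `re s = 2`
the digamma function, approximated by a logarithm (`norm_digamma_sub_log_le`), yields `π M(T)`,
while zeta has positive real part and contributes a bounded argument. On the top edge the argument
of zeta varies by `O(log T)`: this is Backlund's argument (`exists_abs_im_integral_logDeriv_le`), in
which Jensen's formula bounds the number of nearby zeros and Borel–Carathéodory controls what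
remains after dividing them out.

The polynomial growth this requires, and the absence of zeros of height at most `3/2`, come from an
explicit trapezoidal formula for zeta in `re s > -1` (`riemannZeta₁_eq_trapezoid`). The absence of
low zeros lets the contour and the partial summation both start at height 1. -/

/-! ### Trapezoidal formula for zeta, polynomial growth, and absence of low zeros -/

/-- The kernel `{u}(1 - {u})/2` of the trapezoidal rule on unit intervals. -/
noncomputable def trapezoidKernel (u : ℝ) : ℝ := Int.fract u * (1 - Int.fract u) / 2

theorem measurable_trapezoidKernel : Measurable trapezoidKernel := by
  unfold trapezoidKernel
  fun_prop

theorem trapezoidKernel_nonneg (u : ℝ) : 0 ≤ trapezoidKernel u := by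
  have h0 := Int.fract_nonneg u
  have h1 := (Int.fract_lt_one u).le
  unfold trapezoidKernel
  have : 0 ≤ 1 - Int.fract u := by linarith
  positivity

theorem trapezoidKernel_le (u : ℝ) : trapezoidKernel u ≤ 1 / 8 := by
  unfold trapezoidKernel
  nlinarith [sq_nonneg (Int.fract u - 1 / 2)]

theorem norm_trapezoidKernel_le (u : ℝ) : ‖(trapezoidKernel u : ℂ)‖ ≤ 1 / 8 := by
  rw [Complex.norm_real, Real.norm_of_nonneg (trapezoidKernel_nonneg u)]
  exact trapezoidKernel_le u

/-- The remainder integral in the trapezoidal approximation to the Riemann zeta-function. -/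
noncomputable def zetaRemainder (s : ℂ) : ℂ :=
  ∫ u in Ioi (1 : ℝ), (trapezoidKernel u : ℂ) * (u : ℂ) ^ (-s - 2)

theorem integrableOn_zetaRemainder {s : ℂ} (hs : -1 < s.re) :
    IntegrableOn (fun u : ℝ => (trapezoidKernel u : ℂ) * (u : ℂ) ^ (-s - 2)) (Ioi 1) := by
  have h : IntegrableOn (fun u : ℝ => (u : ℂ) ^ (-s - 2)) (Ioi 1) :=
    integrableOn_Ioi_cpow_of_lt (by simp; linarith) one_pos
  refine h.bdd_mul (c := 1 / 8) ?_ ?_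
  · exact (Complex.measurable_ofReal.comp measurable_trapezoidKernel).aestronglyMeasurable
  · exact Eventually.of_forall fun u => norm_trapezoidKernel_le u

theorem norm_zetaRemainder_le {s : ℂ} (hs : -1 < s.re) :
    ‖zetaRemainder s‖ ≤ 1 / (8 * (s.re + 1)) := by
  have hint : IntegrableOn (fun u : ℝ => 1 / 8 * u ^ (-s.re - 2)) (Ioi 1) :=
    (integrableOn_Ioi_rpow_of_lt (by linarith) one_pos).const_mul _
  have h1 : ‖zetaRemainder s‖ ≤ ∫ u in Ioi (1 : ℝ), 1 / 8 * u ^ (-s.re - 2) := by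
    refine norm_integral_le_of_norm_le hint ?_
    refine (ae_restrict_iff' measurableSet_Ioi).mpr (Eventually.of_forall fun u hu => ?_)
    have hu0 : 0 < u := one_pos.trans hu
    rw [norm_mul, Complex.norm_cpow_eq_rpow_re_of_pos hu0]
    simp only [sub_re, neg_re, re_ofNat]
    gcongr
    exact norm_trapezoidKernel_le u
  refine h1.trans_eq ?_
  rw [integral_const_mul, integral_Ioi_rpow_of_lt (by linarith) one_pos]
  have : s.re + 1 ≠ 0 := by linarith
  have h3 : -s.re - 2 + 1 = -(s.re + 1) := by ring
  rw [h3, Real.one_rpow]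
  field_simp

/-- The remainder is the Mellin transform at `-s - 1` of the kernel cut off to `(1, ∞)`. The cut-off
kernel is bounded, which gives convergence at infinity exactly for `-1 < re s`, and it vanishes near
0, so the other end imposes no condition. -/
theorem differentiableAt_zetaRemainder {s : ℂ} (hs : -1 < s.re) :
    DifferentiableAt ℂ zetaRemainder s := by
  set f : ℝ → ℂ := (Ioi (1 : ℝ)).indicator fun u => (trapezoidKernel u : ℂ) with hf
  have hbound : ∀ u, ‖f u‖ ≤ 1 / 8 := fun u => by
    by_cases h : u ∈ Ioi (1 : ℝ)
    · simpa [hf, h] using norm_trapezoidKernel_le u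
    · simp [hf, h]
  have hmeas : Measurable f :=
    (Complex.measurable_ofReal.comp measurable_trapezoidKernel).indicator measurableSet_Ioi
  have hm : ∀ z, zetaRemainder z = mellin f (-z - 1) := fun z => by
    unfold zetaRemainder mellin
    rw [← integral_indicator measurableSet_Ioi, ← integral_indicator measurableSet_Ioi]
    congr 1
    ext u
    by_cases h : u ∈ Ioi (1 : ℝ)
    · have h0 : u ∈ Ioi (0 : ℝ) := mem_Ioi.mpr (one_pos.trans h)
      rw [indicator_of_mem h, indicator_of_mem h0, hf, indicator_of_mem h, smul_eq_mul, mul_comm]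
      congr 2
      ring
    · rw [indicator_of_notMem h]
      by_cases h0 : u ∈ Ioi (0 : ℝ)
      · rw [indicator_of_mem h0, hf, indicator_of_notMem h, smul_zero]
      · rw [indicator_of_notMem h0]
  have hfun : zetaRemainder = mellin f ∘ fun z => -z - 1 := funext hm
  rw [hfun]
  refine DifferentiableAt.comp s ?_ (by fun_prop)
  refine mellin_differentiableAt_of_isBigO_rpow (a := 0) (b := -s.re - 2) ?_ ?_ ?_ ?_ ?_
  · refine LocallyIntegrable.locallyIntegrableOn ?_ _
    refine (locallyIntegrable_const (1 / 8 : ℝ)).mono hmeas.aestronglyMeasurable ?_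
    exact Eventually.of_forall fun u => (hbound u).trans (by simp)
  · refine Asymptotics.IsBigO.of_bound (1 / 8) (Eventually.of_forall fun u => ?_)
    simpa using hbound u
  · simp; linarith
  · have : f =ᶠ[𝓝[>] 0] 0 := by
      filter_upwards [Ioo_mem_nhdsGT (one_pos (α := ℝ))] with u hu
      simp [hf, hu.2.le]
    exact this.trans_isBigO (Asymptotics.isBigO_zero _ _)
  · simp

/-- Two integrations by parts: on the unit interval the kernel `k` has `k'' = -1`, vanishes at both
ends, and has `k' = ±1/2` there, which produces the trapezoidal average. The function `H` in the
proof is the resulting antiderivative. -/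
theorem intervalIntegral_trapezoid {s : ℂ} (hs : s ≠ 1) {n : ℕ} (hn : 1 ≤ n) :
    s * (s + 1) * ∫ u in (n : ℝ)..((n + 1 : ℕ) : ℝ), (trapezoidKernel u : ℂ) * (u : ℂ) ^ (-s - 2) =
      ((n : ℂ) ^ (-s) + ((n + 1 : ℕ) : ℂ) ^ (-s)) / 2 -
        (((n + 1 : ℕ) : ℂ) ^ (1 - s) - (n : ℂ) ^ (1 - s)) / (1 - s) := by
  have hn0 : (0 : ℝ) < n := by exact_mod_cast hn
  have h1s : 1 - s ≠ 0 := sub_ne_zero.mpr hs.symm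
  rw [← intervalIntegral.integral_const_mul]
  set H : ℝ → ℂ := fun u => ((u - n) * (1 - (u - n)) / 2) * (-s * (u : ℂ) ^ (-s - 1)) -
    (1 / 2 - (u - n)) * (u : ℂ) ^ (-s) - (u : ℂ) ^ (1 - s) / (1 - s) with hH
  have hderiv : ∀ u ∈ uIcc (n : ℝ) ((n + 1 : ℕ) : ℝ), HasDerivAt H
      (s * (s + 1) * (((u - n) * (1 - (u - n)) / 2) * (u : ℂ) ^ (-s - 2))) u := by
    intro u hu
    rw [uIcc_of_le (by push_cast; linarith)] at hu
    have hu0 : u ≠ 0 := (hn0.trans_le hu.1).ne'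
    have hu0' : (u : ℂ) ≠ 0 := by exact_mod_cast hu0
    have d0 : HasDerivAt (fun u : ℝ => (u : ℂ) - n) 1 u := by
      simpa using (HasDerivAt.ofReal_comp (hasDerivAt_id u)).sub_const (n : ℂ)
    have slit : (u : ℂ) ∈ slitPlane := by
      simp only [ofReal_mem_slitPlane]; exact hn0.trans_le hu.1
    have dp : ∀ c : ℂ, HasDerivAt (fun u : ℝ => (u : ℂ) ^ c) (c * (u : ℂ) ^ (c - 1)) u := by
      intro c
      have := (HasDerivAt.comp_ofReal (z := u) ((hasDerivAt_id (u : ℂ)).cpow_const (c := c) slit))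
      simpa using this
    have e1 := (((d0.mul (d0.const_sub 1)).div_const 2).mul ((dp (-s - 1)).const_mul (-s))).sub
      ((d0.const_sub (1 / 2)).mul (dp (-s))) |>.sub ((dp (1 - s)).div_const (1 - s))
    refine e1.congr_deriv ?_
    have a1 : (u : ℂ) ^ (-s - 1 - 1) = (u : ℂ) ^ (-s - 2) := by ring_nf
    have a2 : (u : ℂ) ^ (-s - 1) = (u : ℂ) ^ (-s - 2) * u := by
      rw [show -s - 1 = -s - 2 + 1 by ring, cpow_add _ _ hu0', cpow_one]
    have a3 : (u : ℂ) ^ (-s) = (u : ℂ) ^ (-s - 2) * u * u := by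
      rw [show -s = -s - 2 + 1 + 1 by ring, cpow_add _ _ hu0', cpow_add _ _ hu0', cpow_one]
      ring_nf
    have a4 : (u : ℂ) ^ (1 - s - 1) = (u : ℂ) ^ (-s - 2) * u * u := by
      rw [← a3]; ring_nf
    have a5 : (1 - s) * (u : ℂ) ^ (1 - s - 1) / (1 - s) = (u : ℂ) ^ (1 - s - 1) := by
      field_simp
    rw [a5]
    simp only [Pi.mul_apply, a1, a2, a3, a4]
    ring
  have hcongr : ∫ u in (n : ℝ)..((n + 1 : ℕ) : ℝ),
      s * (s + 1) * ((trapezoidKernel u : ℂ) * (u : ℂ) ^ (-s - 2)) =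
      ∫ u in (n : ℝ)..((n + 1 : ℕ) : ℝ),
        s * (s + 1) * (((u - n) * (1 - (u - n)) / 2) * (u : ℂ) ^ (-s - 2)) := by
    rw [intervalIntegral.integral_of_le (by simp), intervalIntegral.integral_of_le (by simp),
      integral_Ioc_eq_integral_Ioo, integral_Ioc_eq_integral_Ioo]
    refine setIntegral_congr_fun measurableSet_Ioo fun u hu => ?_
    have hfr : Int.fract u = u - n := by
      rw [Int.fract_eq_iff]
      refine ⟨by linarith [hu.1], by have := hu.2; push_cast at this; linarith, n, by simp⟩
    simp only [trapezoidKernel, hfr]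
    push_cast
    ring
  rw [hcongr, intervalIntegral.integral_eq_sub_of_hasDerivAt hderiv]
  · simp only [hH]
    push_cast
    ring
  · refine ContinuousOn.intervalIntegrable fun u hu => ContinuousAt.continuousWithinAt ?_
    rw [uIcc_of_le (by simp)] at hu
    have slit : (u : ℂ) ∈ slitPlane := by
      simp only [ofReal_mem_slitPlane]; exact hn0.trans_le hu.1
    have hc : ContinuousAt (fun u : ℝ => (u : ℂ) ^ (-s - 2)) u :=
      ContinuousAt.comp (g := fun z : ℂ => z ^ (-s - 2)) (continuousAt_cpow_const slit)
        continuous_ofReal.continuousAt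
    fun_prop

/-- Adding the unit-interval identities telescopes the powers `n^{1-s}`; the surviving powers of `N
+ 1` tend to 0 because `1 < re s`. -/
theorem riemannZeta_eq_trapezoid_of_one_lt {s : ℂ} (hs : 1 < s.re) :
    riemannZeta s = 1 / (s - 1) + 1 / 2 + s * (s + 1) * zetaRemainder s := by
  have hs1 : s ≠ 1 := by rintro rfl; simp at hs
  have h1s : 1 - s ≠ 0 := sub_ne_zero.mpr hs1.symm
  have hs0 : s ≠ 0 := by rintro rfl; simp at hs; linarith
  have hint := integrableOn_zetaRemainder (s := s) (by linarith)
  have hlim : Tendsto (fun N : ℕ => s * (s + 1) * ∫ u in (1 : ℝ)..((N + 1 : ℕ) : ℝ),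
      (trapezoidKernel u : ℂ) * (u : ℂ) ^ (-s - 2)) atTop
      (𝓝 (s * (s + 1) * zetaRemainder s)) := by
    refine Tendsto.const_mul _ (intervalIntegral_tendsto_integral_Ioi _ hint ?_)
    exact (tendsto_natCast_atTop_atTop (R := ℝ)).comp (tendsto_add_atTop_nat 1)
  have hsum : ∀ N : ℕ, s * (s + 1) * ∫ u in (1 : ℝ)..((N + 1 : ℕ) : ℝ),
      (trapezoidKernel u : ℂ) * (u : ℂ) ^ (-s - 2) =
      ∑ n ∈ Finset.range N, 1 / ((n + 1 : ℕ) : ℂ) ^ s - 1 / 2 +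
        ((N + 1 : ℕ) : ℂ) ^ (-s) / 2 - (((N + 1 : ℕ) : ℂ) ^ (1 - s) - 1) / (1 - s) := by
    intro N
    induction N with
    | zero => simp
    | succ N ih =>
      have hii : ∀ a b : ℕ, 1 ≤ a → a ≤ b → IntervalIntegrable
          (fun u : ℝ => (trapezoidKernel u : ℂ) * (u : ℂ) ^ (-s - 2)) volume a b := by
        intro a b ha hab
        rw [intervalIntegrable_iff_integrableOn_Ioc_of_le (by exact_mod_cast hab)]
        refine hint.mono_set fun u hu => ?_
        have : (1 : ℝ) ≤ a := by exact_mod_cast ha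
        exact lt_of_le_of_lt this hu.1
      have h1 := hii 1 (N + 1) le_rfl (by omega)
      rw [Nat.cast_one] at h1
      rw [← intervalIntegral.integral_add_adjacent_intervals h1
        (hii (N + 1) (N + 1 + 1) (by omega) (by omega)), mul_add, ih,
        intervalIntegral_trapezoid hs1 (by omega), Finset.sum_range_succ, cpow_neg _ s]
      ring
  have hpow : Tendsto (fun N : ℕ => ((N + 1 : ℕ) : ℂ) ^ (1 - s)) atTop (𝓝 0) := by
    rw [tendsto_zero_iff_norm_tendsto_zero]
    have : ∀ N : ℕ, ‖((N + 1 : ℕ) : ℂ) ^ (1 - s)‖ = ((N + 1 : ℕ) : ℝ) ^ (-(s.re - 1)) := by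
      intro N
      rw [Complex.norm_natCast_cpow_of_pos (by omega)]
      simp
    simp_rw [this]
    exact ((tendsto_rpow_neg_atTop (by linarith)).comp tendsto_natCast_atTop_atTop).comp
      (tendsto_add_atTop_nat 1)
  have hpow2 : Tendsto (fun N : ℕ => ((N + 1 : ℕ) : ℂ) ^ (-s)) atTop (𝓝 0) := by
    rw [tendsto_zero_iff_norm_tendsto_zero]
    have : ∀ N : ℕ, ‖((N + 1 : ℕ) : ℂ) ^ (-s)‖ = ((N + 1 : ℕ) : ℝ) ^ (-s.re) := by
      intro N
      rw [Complex.norm_natCast_cpow_of_pos (by omega)]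
      simp
    simp_rw [this]
    exact ((tendsto_rpow_neg_atTop (by linarith)).comp tendsto_natCast_atTop_atTop).comp
      (tendsto_add_atTop_nat 1)
  have hz : Tendsto (fun N : ℕ => ∑ n ∈ Finset.range N, 1 / ((n + 1 : ℕ) : ℂ) ^ s) atTop
      (𝓝 (riemannZeta s)) := by
    rw [zeta_eq_tsum_one_div_nat_add_one_cpow hs]
    have hsm : Summable fun n : ℕ => 1 / ((n + 1 : ℕ) : ℂ) ^ s :=
      (summable_nat_add_iff 1).mpr (Complex.summable_one_div_nat_cpow.mpr hs)
    simpa using hsm.hasSum.tendsto_sum_nat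
  have hlim2 := ((hz.sub_const (1 / 2)).add (hpow2.div_const 2)).sub
    ((hpow.sub_const 1).div_const (1 - s))
  simp_rw [hsum] at hlim
  have := tendsto_nhds_unique hlim hlim2
  have h1s' : s - 1 ≠ 0 := sub_ne_zero.mpr hs1
  rw [this, show 1 - s = -(s - 1) by ring]
  field_simp
  ring

/-- The trapezoidal formula for `(s - 1) ζ(s)` in the half-plane `-1 < re s`. -/
theorem riemannZeta₁_eq_trapezoid {s : ℂ} (hs : -1 < s.re) :
    riemannZeta₁ s = 1 + (s - 1) / 2 + (s - 1) * s * (s + 1) * zetaRemainder s := by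
  have hU : IsOpen {z : ℂ | -1 < z.re} := isOpen_lt continuous_const continuous_re
  have hpre : IsPreconnected {z : ℂ | -1 < z.re} := (convex_halfSpace_re_gt (-1)).isPreconnected
  have hf : AnalyticOnNhd ℂ riemannZeta₁ {z : ℂ | -1 < z.re} :=
    fun z _ => differentiable_riemannZeta₁.analyticAt z
  have hg : AnalyticOnNhd ℂ (fun s => 1 + (s - 1) / 2 + (s - 1) * s * (s + 1) * zetaRemainder s)
      {z : ℂ | -1 < z.re} := by
    refine DifferentiableOn.analyticOnNhd (fun z hz => ?_) hU
    have := differentiableAt_zetaRemainder hz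
    exact DifferentiableAt.differentiableWithinAt (by fun_prop)
  refine hf.eqOn_of_preconnected_of_eventuallyEq hg hpre (z₀ := 2) (by simp; norm_num) ?_ hs
  have : {z : ℂ | 1 < z.re} ∈ 𝓝 (2 : ℂ) :=
    (isOpen_lt continuous_const continuous_re).mem_nhds (by simp)
  filter_upwards [this] with z hz
  have hz1 : z ≠ 1 := by rintro rfl; simp at hz
  have hz1' : z - 1 ≠ 0 := sub_ne_zero.mpr hz1
  have h1 := riemannZeta_eq_inv_sub_mul hz1
  have h2 : riemannZeta₁ z = (z - 1) * riemannZeta z := by rw [h1]; field_simp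
  rw [h2, riemannZeta_eq_trapezoid_of_one_lt hz]
  field_simp

/-- Any polynomial bound suffices: growth enters the argument estimate only through its logarithm.
-/
theorem norm_riemannZeta₁_le {s : ℂ} (hs : 0 ≤ s.re) :
    ‖riemannZeta₁ s‖ ≤ 2 * (1 + ‖s‖) ^ 3 := by
  rw [riemannZeta₁_eq_trapezoid (by linarith)]
  have hK : ‖zetaRemainder s‖ ≤ 1 / 8 := by
    refine (norm_zetaRemainder_le (by linarith)).trans ?_
    gcongr
    linarith
  have ha : ‖s - 1‖ ≤ ‖s‖ + 1 := by simpa using norm_sub_le s 1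
  have hb : ‖s + 1‖ ≤ ‖s‖ + 1 := by simpa using norm_add_le s 1
  have hp : 0 ≤ ‖s‖ := norm_nonneg s
  calc ‖1 + (s - 1) / 2 + (s - 1) * s * (s + 1) * zetaRemainder s‖
      ≤ 1 + (‖s‖ + 1) / 2 + (‖s‖ + 1) * ‖s‖ * (‖s‖ + 1) * (1 / 8) := by
        refine (norm_add_le _ _).trans (add_le_add ((norm_add_le _ _).trans ?_) ?_)
        · simp only [norm_one, norm_div, norm_ofNat]
          gcongr
        · simp only [norm_mul]
          gcongr
    _ ≤ 2 * (1 + ‖s‖) ^ 3 := by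
        nlinarith [pow_nonneg hp 2, pow_nonneg hp 3]

/-- The zeta-function has no zeros in the closed strip `0 ≤ re s ≤ 1` with `|im s| ≤ 3/2`. -/
theorem riemannZeta_ne_zero_of_abs_im_le {s : ℂ} (h0 : 0 ≤ s.re) (h1 : s.re ≤ 1)
    (ht : |s.im| ≤ 3 / 2) : riemannZeta s ≠ 0 := by
  rcases eq_or_ne s 1 with rfl | hs1
  · exact riemannZeta_ne_zero_of_one_le_re (by simp)
  intro hz
  have hs1' : s - 1 ≠ 0 := sub_ne_zero.mpr hs1
  have h2 : riemannZeta₁ s = 0 := by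
    have := riemannZeta_eq_inv_sub_mul hs1
    rw [hz] at this
    simpa [hs1'] using this.symm
  rw [riemannZeta₁_eq_trapezoid (by linarith)] at h2
  -- Since `1 + (s - 1)/2 = (s + 1)/2`, the factor `s + 1` splits off. A zero then forces `|s - 1|
  -- |s| |R(s)| = 1/2` with `R` the remainder, whereas the left side is at most `(1 + (3/2)^2)/8 =
  -- 13/32`.
  have h3 : (s + 1) * (1 / 2 + (s - 1) * s * zetaRemainder s) = 0 := by
    rw [← h2]; ring
  have hsp : s + 1 ≠ 0 := by
    intro h
    have := congrArg re h
    simp at this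
    linarith
  have h4 : (s - 1) * s * zetaRemainder s = -(1 / 2) :=
    eq_neg_of_add_eq_zero_right ((mul_eq_zero.mp h3).resolve_left hsp)
  have h5 : ‖s - 1‖ * ‖s‖ * ‖zetaRemainder s‖ = 1 / 2 := by
    rw [← norm_mul, ← norm_mul, h4]; simp
  have hK : ‖zetaRemainder s‖ ≤ 1 / 8 := by
    refine (norm_zetaRemainder_le (by linarith)).trans ?_
    gcongr
    linarith
  have ht2 : s.im ^ 2 ≤ (3 / 2) ^ 2 := sq_le_sq' (by linarith [abs_le.mp ht]) (abs_le.mp ht).2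
  have hn1 : ‖s - 1‖ ^ 2 ≤ 13 / 4 := by
    rw [Complex.sq_norm, normSq_apply]
    simp only [sub_re, one_re, sub_im, one_im]
    nlinarith
  have hn2 : ‖s‖ ^ 2 ≤ 13 / 4 := by
    rw [Complex.sq_norm, normSq_apply]
    nlinarith
  have hm : ‖s - 1‖ * ‖s‖ ≤ 13 / 4 := by nlinarith [sq_nonneg (‖s - 1‖ - ‖s‖)]
  have : ‖s - 1‖ * ‖s‖ * ‖zetaRemainder s‖ ≤ 13 / 4 * (1 / 8) := by gcongr
  linarith

/-! ### Dividing zeros out of an entire function -/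

theorem Differentiable.analyticOrderAt_ne_top {f : ℂ → ℂ} (hf : Differentiable ℂ f)
    (h0 : ∃ z, f z ≠ 0) (ρ : ℂ) : analyticOrderAt f ρ ≠ ⊤ := by
  obtain ⟨w, hw⟩ := h0
  refine AnalyticOnNhd.analyticOrderAt_ne_top_of_isPreconnected (U := univ) (x := w)
    (fun z _ => hf.analyticAt z) isPreconnected_univ (mem_univ _) (mem_univ _) ?_
  rw [(hf.analyticAt w).analyticOrderAt_eq_zero.mpr hw]
  simp

/-- The quotient `f / (z - ρ)^n`, filled in at `ρ` by the value of the local cofactor, agrees near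
`ρ` with that analytic cofactor, so it is entire. -/
theorem Differentiable.exists_eq_pow_mul {f : ℂ → ℂ} (hf : Differentiable ℂ f)
    (h0 : ∃ z, f z ≠ 0) (ρ : ℂ) :
    ∃ g : ℂ → ℂ, Differentiable ℂ g ∧ (∀ z, f z = (z - ρ) ^ analyticOrderNatAt f ρ * g z) ∧
      g ρ ≠ 0 := by
  set n := analyticOrderNatAt f ρ
  have hn : analyticOrderAt f ρ = n :=
    (Nat.cast_analyticOrderNatAt (hf.analyticOrderAt_ne_top h0 ρ)).symm
  obtain ⟨g₀, hg₀, hne, hev⟩ := (hf.analyticAt ρ).analyticOrderAt_eq_natCast.mp hn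
  set g : ℂ → ℂ := fun z => if z = ρ then g₀ ρ else f z / (z - ρ) ^ n with hg
  have hgρ : g ρ = g₀ ρ := by simp [hg]
  have hgg : g =ᶠ[𝓝 ρ] g₀ := by
    filter_upwards [hev] with z hz
    by_cases h : z = ρ
    · rw [h, hgρ]
    · have : (z - ρ) ^ n ≠ 0 := pow_ne_zero _ (sub_ne_zero.mpr h)
      simp only [hg, h, if_false, hz, smul_eq_mul]
      field_simp
  refine ⟨g, fun z => ?_, fun z => ?_, hgρ ▸ hne⟩
  · by_cases h : z = ρ
    · rw [h]
      exact hg₀.differentiableAt.congr_of_eventuallyEq hgg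
    · have : g =ᶠ[𝓝 z] fun z => f z / (z - ρ) ^ n := by
        filter_upwards [isOpen_ne.mem_nhds h] with w hw
        simp [hg, show w ≠ ρ from hw]
      refine DifferentiableAt.congr_of_eventuallyEq ?_ this
      exact (hf z).div (by fun_prop) (pow_ne_zero _ (sub_ne_zero.mpr h))
  · by_cases h : z = ρ
    · subst h
      have := hev.self_of_nhds
      rw [hgρ]
      simpa using this
    · have : (z - ρ) ^ n ≠ 0 := pow_ne_zero _ (sub_ne_zero.mpr h)
      simp only [hg, h, if_false]
      field_simp

/-- Finitely many zeros of an entire function can be divided out with their multiplicities. -/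
theorem Differentiable.exists_eq_prod_pow_mul {f : ℂ → ℂ} (hf : Differentiable ℂ f)
    (h0 : ∃ z, f z ≠ 0) (Z : Finset ℂ) :
    ∃ g : ℂ → ℂ, Differentiable ℂ g ∧
      (∀ z, f z = (∏ ρ ∈ Z, (z - ρ) ^ analyticOrderNatAt f ρ) * g z) ∧ ∀ ρ ∈ Z, g ρ ≠ 0 := by
  classical
  induction Z using Finset.induction_on with
  | empty => exact ⟨f, hf, by simp, by simp⟩
  | insert ρ Z hρ ih =>
    obtain ⟨g, hg, hfac, hne⟩ := ih
    have hg0 : ∃ z, g z ≠ 0 := by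
      obtain ⟨w, hw⟩ := h0
      exact ⟨w, fun h => hw (by rw [hfac, h, mul_zero])⟩
    obtain ⟨g', hg', hfac', hne'⟩ := hg.exists_eq_pow_mul hg0 ρ
    have hP : Differentiable ℂ fun z => ∏ ρ ∈ Z, (z - ρ) ^ analyticOrderNatAt f ρ := by fun_prop
    have hPρ : ∏ ρ' ∈ Z, (ρ - ρ') ^ analyticOrderNatAt f ρ' ≠ 0 :=
      Finset.prod_ne_zero_iff.mpr fun ρ' hρ' => pow_ne_zero _ (sub_ne_zero.mpr (by
        rintro rfl; exact hρ hρ'))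
    have hord : analyticOrderNatAt f ρ = analyticOrderNatAt g ρ := by
      have hfun : f = (fun z => ∏ ρ ∈ Z, (z - ρ) ^ analyticOrderNatAt f ρ) * g := funext hfac
      have : analyticOrderAt f ρ = analyticOrderAt g ρ := by
        conv_lhs => rw [hfun]
        rw [analyticOrderAt_mul (hP.analyticAt ρ) (hg.analyticAt ρ),
          (hP.analyticAt ρ).analyticOrderAt_eq_zero.mpr hPρ, zero_add]
      simp [analyticOrderNatAt, this]
    refine ⟨g', hg', fun z => ?_, fun ρ' hρ' => ?_⟩
    · rw [Finset.prod_insert hρ, hfac z, hfac' z, hord]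
      ring
    · rcases Finset.mem_insert.mp hρ' with rfl | h
      · exact hne'
      · intro h'
        exact hne ρ' h (by rw [hfac', h', mul_zero])

theorem logDeriv_eq_sum_add {f g : ℂ → ℂ} {Z : Finset ℂ} {m : ℂ → ℕ} (hg : Differentiable ℂ g)
    (hfac : ∀ z, f z = (∏ ρ ∈ Z, (z - ρ) ^ m ρ) * g z) {z : ℂ} (hz : ∀ ρ ∈ Z, z ≠ ρ)
    (hgz : g z ≠ 0) :
    logDeriv f z = ∑ ρ ∈ Z, (m ρ : ℂ) * (z - ρ)⁻¹ + logDeriv g z := by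
  have hne : ∀ ρ ∈ Z, (z - ρ) ^ m ρ ≠ 0 := fun ρ hρ => pow_ne_zero _ (sub_ne_zero.mpr (hz ρ hρ))
  rw [show f = fun z => (∏ ρ ∈ Z, (z - ρ) ^ m ρ) * g z from funext hfac,
    logDeriv_mul z (Finset.prod_ne_zero_iff.mpr hne) hgz (by fun_prop) (hg z),
    logDeriv_prod hne (fun ρ _ => by fun_prop)]
  congr 1
  refine Finset.sum_congr rfl fun ρ _ => ?_
  rw [logDeriv_fun_pow (by fun_prop)]
  simp [logDeriv_apply]

/-! ### The argument principle on a rectangle -/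

/-- In the open first quadrant a quarter turn clockwise stays within the principal branch. Comparing
the branches used on adjacent sides of a rectangle gives one such quarter turn at each corner. -/
theorem log_neg_I_mul {z : ℂ} (hre : 0 < z.re) (him : 0 < z.im) :
    log (-I * z) = log z - I * (Real.pi / 2) := by
  have hz : z ≠ 0 := by rintro rfl; simp at hre
  rw [log_mul (by simp) hz, log_neg_I]
  · ring
  · rw [arg_neg_I]
    have h1 := (arg_nonneg_iff (z := z)).mpr him.le
    have h2 := arg_le_pi z
    constructor <;> linarith [Real.pi_pos]

/-- The factor `w` rotates the branch cut away from the segment; the antiderivative `log (w * ·)`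
has derivative independent of `w`. -/
theorem integral_horizontal_inv_sub {a b p : ℝ} {ρ w : ℂ} (hw : w ≠ 0)
    (h : ∀ x ∈ uIcc a b, w * ((x : ℂ) + p * I - ρ) ∈ slitPlane) :
    ∫ x in a..b, ((x : ℂ) + p * I - ρ)⁻¹ =
      log (w * ((b : ℂ) + p * I - ρ)) - log (w * ((a : ℂ) + p * I - ρ)) := by
  have hne : ∀ x ∈ uIcc a b, (x : ℂ) + p * I - ρ ≠ 0 := fun x hx h0 => by
    have := h x hx
    rw [h0, mul_zero] at this
    simp at this
  refine intervalIntegral.integral_eq_sub_of_hasDerivAt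
    (f := fun x : ℝ => log (w * ((x : ℂ) + p * I - ρ))) (fun x hx => ?_) ?_
  · have d : HasDerivAt (fun x : ℝ => w * ((x : ℂ) + p * I - ρ)) w x := by
      simpa using (((HasDerivAt.ofReal_comp (hasDerivAt_id x)).add_const (p * I)).sub_const
        ρ).const_mul w
    refine (d.clog_real (h x hx)).congr_deriv ?_
    have := hne x hx
    field_simp
  · exact (ContinuousOn.inv₀ (by fun_prop) hne).intervalIntegrable

theorem integral_vertical_inv_sub {a p q : ℝ} {ρ w : ℂ} (hw : w ≠ 0)
    (h : ∀ y ∈ uIcc p q, w * ((a : ℂ) + y * I - ρ) ∈ slitPlane) :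
    I * ∫ y in p..q, ((a : ℂ) + y * I - ρ)⁻¹ =
      log (w * ((a : ℂ) + q * I - ρ)) - log (w * ((a : ℂ) + p * I - ρ)) := by
  have hne : ∀ y ∈ uIcc p q, (a : ℂ) + y * I - ρ ≠ 0 := fun x hx h0 => by
    have := h x hx
    rw [h0, mul_zero] at this
    simp at this
  rw [← intervalIntegral.integral_const_mul]
  refine intervalIntegral.integral_eq_sub_of_hasDerivAt
    (f := fun y : ℝ => log (w * ((a : ℂ) + y * I - ρ))) (fun y hy => ?_) ?_
  · have d : HasDerivAt (fun y : ℝ => w * ((a : ℂ) + y * I - ρ)) (w * I) y := by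
      simpa using ((((HasDerivAt.ofReal_comp (hasDerivAt_id y)).mul_const I).const_add
        (a : ℂ)).sub_const ρ).const_mul w
    refine (d.clog_real (h y hy)).congr_deriv ?_
    have := hne y hy
    field_simp
  · exact (ContinuousOn.mul continuousOn_const
      (ContinuousOn.inv₀ (by fun_prop) hne)).intervalIntegrable

/-- The integral of `f` over the boundary of the rectangle `[a, b] × [p, q]`. -/
noncomputable def rectIntegral (f : ℂ → ℂ) (a b p q : ℝ) : ℂ :=
  (∫ x in a..b, f (x + p * I)) - (∫ x in a..b, f (x + q * I)) +
    I * (∫ y in p..q, f (b + y * I)) - I * ∫ y in p..q, f (a + y * I)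

/-- For the bottom, top, right and left sides the rotations `I`, `-I`, `1`, `-1` bring `z - ρ` into
the right half-plane. At each corner the two rotated logarithms differ by `iπ/2`, and the four
differences add up to `2πi`. -/
theorem rectIntegral_inv_sub {a b p q : ℝ} {ρ : ℂ} (ha : a < ρ.re) (hb : ρ.re < b)
    (hp : p < ρ.im) (hq : ρ.im < q) :
    rectIntegral (fun z => (z - ρ)⁻¹) a b p q = 2 * Real.pi * I := by
  have hab : a ≤ b := (ha.trans hb).le
  have hpq : p ≤ q := (hp.trans hq).le
  unfold rectIntegral
  rw [integral_horizontal_inv_sub (p := p) (w := I) I_ne_zero,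
    integral_horizontal_inv_sub (p := q) (w := -I) (neg_ne_zero.mpr I_ne_zero),
    integral_vertical_inv_sub (a := b) (w := 1) one_ne_zero,
    integral_vertical_inv_sub (a := a) (w := -1) (by simp)]
  · have e1 := log_neg_I_mul (z := I * ((b : ℂ) + p * I - ρ)) (by simp; linarith)
      (by simp; linarith)
    have e2 := log_neg_I_mul (z := (b : ℂ) + q * I - ρ) (by simp; linarith) (by simp; linarith)
    have e3 := log_neg_I_mul (z := -I * ((a : ℂ) + q * I - ρ)) (by simp; linarith)
      (by simp; linarith)
    have e4 := log_neg_I_mul (z := -1 * ((a : ℂ) + p * I - ρ)) (by simp; linarith)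
      (by simp; linarith)
    rw [← mul_assoc, show -I * I = 1 by simp] at e1
    rw [← mul_assoc, show -I * -I = -1 by simp] at e3
    rw [← mul_assoc, show -I * -1 = I by simp] at e4
    rw [e1, e2, e3, e4]
    simp only [one_mul]
    ring
  · intro y _
    refine Or.inl ?_
    simp; linarith
  · intro y _
    refine Or.inl ?_
    simp; linarith
  · intro y _
    refine Or.inl ?_
    simp; linarith
  · intro y _
    refine Or.inl ?_
    simp; linarith

/-- The argument principle for an entire function on a rectangle. -/
theorem rectIntegral_logDeriv {f : ℂ → ℂ} (hf : Differentiable ℂ f) {a b p q : ℝ} (hab : a ≤ b)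
    (hpq : p ≤ q) {Z : Finset ℂ}
    (hZ : ∀ ρ ∈ Z, a < ρ.re ∧ ρ.re < b ∧ p < ρ.im ∧ ρ.im < q)
    (hzero : ∀ z ∈ Icc a b ×ℂ Icc p q, f z = 0 → z ∈ Z) :
    rectIntegral (logDeriv f) a b p q =
      2 * Real.pi * I * ∑ ρ ∈ Z, (analyticOrderNatAt f ρ : ℂ) := by
  have hcorner : (a + p * I : ℂ) ∈ Icc a b ×ℂ Icc p q := by
    simp [mem_reProdIm, hab, hpq]
  -- The corner lies outside the open rectangle containing `Z`, so `f` does not vanish there and is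
  -- not identically zero.
  have h0 : ∃ z, f z ≠ 0 := ⟨a + p * I, fun h => by simpa using (hZ _ (hzero _ hcorner h)).1⟩
  obtain ⟨g, hg, hfac, hgZ⟩ := hf.exists_eq_prod_pow_mul h0 Z
  have hgne : ∀ z ∈ Icc a b ×ℂ Icc p q, g z ≠ 0 := fun z hz h => by
    have hfz : f z = 0 := by rw [hfac, h, mul_zero]
    exact hgZ z (hzero z hz hfz) h
  set m := analyticOrderNatAt f
  have hgd : DifferentiableOn ℂ (logDeriv g) (Icc a b ×ℂ Icc p q) := fun z hz =>
    ((hg.deriv z).div (hg z)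
      (hgne z hz)).differentiableWithinAt
  have hgi : rectIntegral (logDeriv g) a b p q = 0 := by
    have := integral_boundary_rect_eq_zero_of_differentiableOn (logDeriv g) (a + p * I) (b + q * I)
      (by simpa [uIcc_of_le hab, uIcc_of_le hpq] using hgd)
    simpa [rectIntegral] using this
  have hmain : ∀ z ∈ Icc a b ×ℂ Icc p q, (∀ ρ ∈ Z, z ≠ ρ) →
      logDeriv f z = ∑ ρ ∈ Z, (m ρ : ℂ) * (z - ρ)⁻¹ + logDeriv g z := fun z hz hzZ =>
    logDeriv_eq_sum_add hg hfac hzZ (hgne z hz)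
  have hside : ∀ (γ : ℝ → ℂ) (c d : ℝ), c ≤ d → Continuous γ →
      (∀ t ∈ Icc c d, γ t ∈ Icc a b ×ℂ Icc p q ∧ ∀ ρ ∈ Z, γ t ≠ ρ) →
      ∫ t in c..d, logDeriv f (γ t) = ∑ ρ ∈ Z, (m ρ : ℂ) * (∫ t in c..d, (γ t - ρ)⁻¹) +
        ∫ t in c..d, logDeriv g (γ t) := by
    intro γ c d hcd hγ h
    have hi : ∀ ρ ∈ Z, IntervalIntegrable (fun t => (m ρ : ℂ) * (γ t - ρ)⁻¹) volume c d :=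
      fun ρ hρ => by
        refine ContinuousOn.intervalIntegrable ?_
        rw [uIcc_of_le hcd]
        exact continuousOn_const.mul (ContinuousOn.inv₀ (by fun_prop)
          fun t ht => sub_ne_zero.mpr ((h t ht).2 ρ hρ))
    simp_rw [← intervalIntegral.integral_const_mul]
    rw [← intervalIntegral.integral_finsetSum hi, ← intervalIntegral.integral_add]
    · refine intervalIntegral.integral_congr fun t ht => ?_
      rw [uIcc_of_le hcd] at ht
      exact hmain _ (h t ht).1 (h t ht).2
    · simpa [Finset.sum_fn] using IntervalIntegrable.sum Z hi
    · refine ContinuousOn.intervalIntegrable ?_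
      rw [uIcc_of_le hcd]
      exact hgd.continuousOn.comp hγ.continuousOn fun t ht => (h t ht).1
  have key : rectIntegral (logDeriv f) a b p q =
      ∑ ρ ∈ Z, (m ρ : ℂ) * rectIntegral (fun z => (z - ρ)⁻¹) a b p q +
        rectIntegral (logDeriv g) a b p q := by
    unfold rectIntegral
    rw [hside (fun x => x + p * I) a b hab (by fun_prop), hside (fun x => x + q * I) a b hab
      (by fun_prop), hside (fun y => b + y * I) p q hpq (by fun_prop),
      hside (fun y => a + y * I) p q hpq (by fun_prop)]
    · simp only [mul_sub, mul_add, Finset.sum_sub_distrib, Finset.sum_add_distrib,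
        Finset.mul_sum, mul_left_comm]
      ring
    · refine fun y hy => ⟨by simp [mem_reProdIm, hab, hy.1, hy.2], fun ρ hρ h => ?_⟩
      have := (hZ ρ hρ).1
      rw [← h] at this
      simp at this
    · refine fun y hy => ⟨by simp [mem_reProdIm, hab, hy.1, hy.2], fun ρ hρ h => ?_⟩
      have := (hZ ρ hρ).2.1
      rw [← h] at this
      simp at this
    · refine fun y hy => ⟨by simp [mem_reProdIm, hpq, hy.1, hy.2], fun ρ hρ h => ?_⟩
      have := (hZ ρ hρ).2.2.2
      rw [← h] at this
      simp at this
    · refine fun y hy => ⟨by simp [mem_reProdIm, hpq, hy.1, hy.2], fun ρ hρ h => ?_⟩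
      have := (hZ ρ hρ).2.2.1
      rw [← h] at this
      simp at this
  rw [key, hgi, add_zero, Finset.mul_sum]
  refine Finset.sum_congr rfl fun ρ hρ => ?_
  obtain ⟨h1, h2, h3, h4⟩ := hZ ρ hρ
  rw [rectIntegral_inv_sub h1 h2 h3 h4, mul_comm]

/-! ### Variation of the argument along a horizontal segment -/

/-- The segment does not meet the cut of `log (z - ρ)`, so the imaginary part is a difference of two
principal arguments. Each zero near the segment thus costs a bounded amount, however close it is. -/
theorem abs_im_integral_horizontal_inv_sub_le {a b p : ℝ} {ρ : ℂ} (h : ρ.im ≠ p) :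
    |(∫ x in a..b, ((x : ℂ) + p * I - ρ)⁻¹).im| ≤ 2 * Real.pi := by
  rw [integral_horizontal_inv_sub (w := 1) one_ne_zero]
  · simp only [sub_im, log_im]
    refine (abs_sub _ _).trans ?_
    linarith [abs_arg_le_pi (1 * ((b : ℂ) + p * I - ρ)), abs_arg_le_pi (1 * ((a : ℂ) + p * I - ρ))]
  · intro x _
    refine Or.inr ?_
    simpa [sub_eq_zero] using h.symm

/-- A nonvanishing holomorphic function on a disc has an exponential representation by a primitive
of its logarithmic derivative. -/
theorem exists_primitive_logDeriv {g : ℂ → ℂ} {c : ℂ} {r : ℝ} (hr : 0 < r) (hg : Differentiable ℂ g)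
    (hne : ∀ z ∈ Metric.ball c r, g z ≠ 0) :
    ∃ G : ℂ → ℂ, (∀ z ∈ Metric.ball c r, HasDerivAt G (logDeriv g z) z) ∧
      ∀ z ∈ Metric.ball c r, g z = g c * exp (G z - G c) := by
  have hd : DifferentiableOn ℂ (logDeriv g) (Metric.ball c r) := fun z hz =>
    ((hg.deriv z).div (hg z) (hne z hz)).differentiableWithinAt
  obtain ⟨G, hG⟩ := hd.isExactOn_ball
  refine ⟨G, hG, fun z hz => ?_⟩
  have hφ : ∀ w ∈ Metric.ball c r, HasDerivAt (fun w => g w * exp (-G w)) 0 w := by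
    intro w hw
    refine ((hg w).hasDerivAt.mul (hG w hw).neg.cexp).congr_deriv ?_
    have := hne w hw
    rw [logDeriv_apply]
    field_simp
    ring
  have := Metric.isOpen_ball.is_const_of_deriv_eq_zero (convex_ball c r).isPreconnected
    (fun w hw => (hφ w hw).differentiableAt.differentiableWithinAt)
    (fun w hw => (hφ w hw).deriv) hz (Metric.mem_ball_self hr)
  rw [sub_eq_add_neg, add_comm, exp_add, ← mul_assoc, ← this, mul_assoc, ← exp_add]
  simp

theorem finset_prod_norm_pow_le {Z : Finset ℂ} {m : ℂ → ℕ} {z : ℂ} {r : ℝ}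
    (h : ∀ ρ ∈ Z, ‖z - ρ‖ ≤ r) :
    ‖∏ ρ ∈ Z, (z - ρ) ^ m ρ‖ ≤ r ^ ∑ ρ ∈ Z, m ρ := by
  rw [norm_prod, ← Finset.prod_pow_eq_pow_sum]
  refine Finset.prod_le_prod (fun _ _ => norm_nonneg _) fun ρ hρ => ?_
  rw [norm_pow]
  exact pow_le_pow_left₀ (norm_nonneg _) (h ρ hρ) _

theorem le_finset_prod_norm_pow {Z : Finset ℂ} {m : ℂ → ℕ} {z : ℂ} {r : ℝ} (hr : 0 ≤ r)
    (h : ∀ ρ ∈ Z, r ≤ ‖z - ρ‖) :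
    r ^ ∑ ρ ∈ Z, m ρ ≤ ‖∏ ρ ∈ Z, (z - ρ) ^ m ρ‖ := by
  rw [norm_prod, ← Finset.prod_pow_eq_pow_sum]
  refine Finset.prod_le_prod (fun _ _ => pow_nonneg hr _) fun ρ hρ => ?_
  rw [norm_pow]
  exact pow_le_pow_left₀ hr (h ρ hρ) _

/-- Jensen's bound for the number of zeros of an entire function in a disc, with the zeros collected
in a finset. -/
theorem exists_finset_zeros_closedBall {f : ℂ → ℂ} (hf : Differentiable ℂ f) {c : ℂ} {r R M : ℝ}
    (hr : 0 < r) (hrR : r < R) (hM : 1 ≤ M) (hc : f c ≠ 0)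
    (hb : ∀ z ∈ Metric.sphere c R, ‖f z‖ ≤ M) :
    ∃ Z : Finset ℂ, (∀ ρ ∈ Z, ρ ∈ Metric.closedBall c r ∧ f ρ = 0) ∧
      (∀ z ∈ Metric.closedBall c r, f z = 0 → z ∈ Z) ∧
      ((∑ ρ ∈ Z, analyticOrderNatAt f ρ : ℕ) : ℝ) ≤ Real.log (M / ‖f c‖) / Real.log (R / r) := by
  have hfa : ∀ s : Set ℂ, AnalyticOnNhd ℂ f s := fun s z _ => hf.analyticAt z
  set D := MeromorphicOn.divisor f (Metric.closedBall c r) with hD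
  have hfin := D.finiteSupport (isCompact_closedBall c r)
  have hDapp : ∀ z ∈ Metric.closedBall c r, D z = (analyticOrderNatAt f z : ℤ) := fun z hz => by
    rw [hD, MeromorphicOn.AnalyticOnNhd.divisor_apply (hfa _) hz,
      ← Nat.cast_analyticOrderNatAt (hf.analyticOrderAt_ne_top ⟨c, hc⟩ z)]
    rfl
  have hmem : ∀ z ∈ Metric.closedBall c r, (D z ≠ 0 ↔ f z = 0) := fun z hz => by
    rw [hDapp z hz]
    have h1 := Nat.cast_analyticOrderNatAt (hf.analyticOrderAt_ne_top ⟨c, hc⟩ z)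
    rw [Ne, Nat.cast_eq_zero, ← (hf.analyticAt z).analyticOrderAt_ne_zero, ← h1]
    simp
  have hball : ∀ z, D z ≠ 0 → z ∈ Metric.closedBall c r := fun z hz => by
    by_contra h
    exact hz (Function.locallyFinsuppWithin.apply_eq_zero_of_notMem D h)
  refine ⟨hfin.toFinset, fun ρ hρ => ?_, fun z hz h0 => ?_, ?_⟩
  · have h := hfin.mem_toFinset.mp hρ
    exact ⟨hball ρ h, (hmem ρ (hball ρ h)).mp h⟩
  · exact hfin.mem_toFinset.mpr ((hmem z hz).mpr h0)
  · have h := AnalyticOnNhd.sum_divisor_le (c := c) (r := r) (R := R) (M := M) (f := f)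
      (by rwa [abs_of_pos hr]) (by rwa [abs_of_pos hr, abs_of_pos (hr.trans hrR)]) hM (hfa _) hc
      (by rwa [abs_of_pos (hr.trans hrR)])
    rw [abs_of_pos hr] at h
    refine le_trans (le_of_eq ?_) h
    rw [finsum_eq_sum_of_support_subset D (s := hfin.toFinset) (by simp)]
    push_cast
    refine Finset.sum_congr rfl fun ρ hρ => ?_
    rw [hDapp ρ (hball ρ (hfin.mem_toFinset.mp hρ))]
    simp

/-- Backlund's estimate for the variation of the argument of an entire function along a horizontal
segment. -/
theorem exists_abs_im_integral_logDeriv_le :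
    ∃ C : ℝ, 0 ≤ C ∧ ∀ (f : ℂ → ℂ) (c : ℂ) (M : ℝ), Differentiable ℂ f → 1 ≤ M →
      (∀ z ∈ Metric.closedBall c (15 / 8), ‖f z‖ ≤ M) → (∀ z, z.im = c.im → f z ≠ 0) →
      |(∫ x in (c.re - 3 / 2)..c.re, logDeriv f (x + c.im * I)).im| ≤
        C * (1 + Real.log (M / ‖f c‖)) := by
  -- Three nested radii are used: the segment has length `3/2`, zeros are removed up to radius
  -- `7/4`, and growth is known up to `15/8`. By Jensen the number of removed zeros is at most `B /
  -- L`, with `B = log (M / ‖f c‖)`.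
  set L := Real.log ((15 / 8) / (7 / 4)) with hL
  have hLpos : 0 < L := Real.log_pos (by norm_num)
  have h14 : 0 ≤ Real.log 14 := Real.log_nonneg (by norm_num)
  refine ⟨(2 * Real.pi + 12 * Real.log 14) / L + 12, by positivity, fun f c M hf hM hb hne => ?_⟩
  have hc : f c ≠ 0 := hne c rfl
  have hcpos : 0 < ‖f c‖ := norm_pos_iff.mpr hc
  obtain ⟨Z, hZ, hZ', hcount⟩ := exists_finset_zeros_closedBall hf (r := 7 / 4) (R := 15 / 8)
    (by norm_num) (by norm_num) hM hc (fun z hz => hb z (Metric.sphere_subset_closedBall hz))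
  obtain ⟨g, hg, hfac, hgZ⟩ := hf.exists_eq_prod_pow_mul ⟨c, hc⟩ Z
  set m := analyticOrderNatAt f
  set n := ∑ ρ ∈ Z, m ρ
  set B := Real.log (M / ‖f c‖) with hB
  have hBnn : 0 ≤ B := Real.log_nonneg ((one_le_div hcpos).mpr (hb c (by simp; norm_num)))
  have hgne : ∀ z, (z ∈ Metric.closedBall c (7 / 4) ∨ z.im = c.im) → g z ≠ 0 := by
    intro z hz h
    have hfz : f z = 0 := by rw [hfac, h, mul_zero]
    rcases hz with hz | hz
    · exact hgZ z (hZ' z hz hfz) h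
    · exact hne z hz hfz
  -- On the outer circle every removed zero is at distance at least `15/8 - 7/4 = 1/8`, so division
  -- costs at most a factor `8^n`; the maximum principle carries the bound inside.
  have hgb : ∀ z ∈ Metric.closedBall c (15 / 8), ‖g z‖ ≤ M * 8 ^ n := by
    intro z hz
    refine norm_le_of_forall_mem_frontier_norm_le (U := Metric.ball c (15 / 8))
      Metric.isBounded_ball hg.diffContOnCl (fun w hw => ?_)
      (by rwa [closure_ball c (by norm_num)])
    rw [frontier_ball c (by norm_num)] at hw
    have h1 : (1 / 8 : ℝ) ^ n ≤ ‖∏ ρ ∈ Z, (w - ρ) ^ m ρ‖ := by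
      refine le_finset_prod_norm_pow (by norm_num) fun ρ hρ => ?_
      have a1 : ‖ρ - c‖ ≤ 7 / 4 := by simpa [dist_eq_norm] using (hZ ρ hρ).1
      have a2 : ‖w - c‖ = 15 / 8 := by simpa [dist_eq_norm] using hw
      have a3 : ‖w - c‖ ≤ ‖w - ρ‖ + ‖ρ - c‖ := norm_sub_le_norm_sub_add_norm_sub w ρ c
      linarith
    have h2 : ‖f w‖ ≤ M := hb w (Metric.sphere_subset_closedBall hw)
    rw [hfac, norm_mul] at h2
    have h3 : (1 / 8 : ℝ) ^ n * ‖g w‖ ≤ M := (by gcongr : _ ≤ _).trans h2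
    have h4 : (8 : ℝ) ^ n * ((1 / 8 : ℝ) ^ n * ‖g w‖) ≤ 8 ^ n * M := by gcongr
    rw [← mul_assoc, ← mul_pow] at h4
    norm_num at h4
    linarith
  have hgc : ‖f c‖ ≤ (7 / 4) ^ n * ‖g c‖ := by
    rw [hfac c, norm_mul]
    gcongr
    refine finset_prod_norm_pow_le fun ρ hρ => ?_
    simpa [dist_eq_norm, norm_sub_rev] using (hZ ρ hρ).1
  have hgcne : g c ≠ 0 := hgne c (Or.inr rfl)
  obtain ⟨G, hG, hGexp⟩ := exists_primitive_logDeriv (c := c) (r := 7 / 4) (by norm_num) hg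
    (fun z hz => hgne z (Or.inl (Metric.ball_subset_closedBall hz)))
  -- The 14 is `8 · 7/4`: a factor 8 for each zero in the upper bound for `g`, and `7/4` for each in
  -- the lower bound at the centre.
  set A := B + n * Real.log 14 with hA
  have hAnn : 0 ≤ A := by positivity
  have hre : ∀ z ∈ Metric.ball c (7 / 4), (G z - G c).re ≤ A := by
    intro z hz
    have h1 : ‖g z‖ = ‖g c‖ * Real.exp (G z - G c).re := by
      conv_lhs => rw [hGexp z hz]
      rw [norm_mul, norm_exp]
    have h2 : ‖g z‖ ≤ M * 8 ^ n := hgb z (Metric.closedBall_subset_closedBall (by norm_num)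
      (Metric.ball_subset_closedBall hz))
    have h3 : Real.exp A = M / ‖f c‖ * 14 ^ n := by
      rw [hA, Real.exp_add, hB, Real.exp_log (by positivity), Real.exp_nat_mul,
        Real.exp_log (by norm_num)]
    rw [← Real.exp_le_exp, h3, div_mul_eq_mul_div, le_div_iff₀ hcpos]
    have h4 : Real.exp (G z - G c).re * ‖f c‖ ≤
        Real.exp (G z - G c).re * ((7 / 4) ^ n * ‖g c‖) := by gcongr
    refine h4.trans ?_
    have h5 : Real.exp (G z - G c).re * ((7 / 4) ^ n * ‖g c‖) = (7 / 4) ^ n * ‖g z‖ := by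
      rw [h1]; ring
    rw [h5]
    calc (7 / 4 : ℝ) ^ n * ‖g z‖ ≤ (7 / 4) ^ n * (M * 8 ^ n) := by gcongr
      _ = M * 14 ^ n := by
        rw [mul_left_comm, ← mul_pow]; norm_num
  -- Borel–Carathéodory at radius `3/2` inside `7/4` has constant `2 · (3/2) / (7/4 - 3/2) = 12`.
  -- The bound `A + 1` replaces `A` to be strictly positive.
  have hBC : ‖G (c - 3 / 2) - G c‖ ≤ 12 * (A + 1) := by
    have := borelCaratheodory_zero (f := fun w => G (c + w) - G c) (M := A + 1) (R := 7 / 4)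
      (z := -3 / 2) (by linarith) ?_ ?_ (by norm_num) ?_ (by simp)
    · norm_num at this
      rw [show c - 3 / 2 = c + -(3 / 2) by ring]
      linarith
    · intro w hw
      have hw' : c + w ∈ Metric.ball c (7 / 4) := by simpa [dist_eq_norm] using hw
      have := (hG _ hw').differentiableAt
      refine DifferentiableAt.differentiableWithinAt (DifferentiableAt.sub_const ?_ _)
      exact DifferentiableAt.comp w this (by fun_prop)
    · intro w hw
      have hw' : c + w ∈ Metric.ball c (7 / 4) := by simpa [dist_eq_norm] using hw
      exact (hre _ hw').trans (by linarith)
    · simp; norm_num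
  have hpt : ∀ x ∈ uIcc (c.re - 3 / 2) c.re, (x + c.im * I : ℂ) ∈ Metric.ball c (7 / 4) := by
    intro x hx
    rw [uIcc_of_le (by linarith)] at hx
    have : (x + c.im * I : ℂ) - c = ((x - c.re : ℝ) : ℂ) := by
      apply Complex.ext <;> simp
    rw [Metric.mem_ball, dist_eq_norm, this, norm_real, Real.norm_eq_abs, abs_lt]
    constructor <;> linarith [hx.1, hx.2]
  have hgi : IntervalIntegrable (fun x : ℝ => logDeriv g (x + c.im * I)) volume (c.re - 3 / 2)
      c.re := by
    refine Continuous.intervalIntegrable ?_ _ _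
    have hgn : ∀ x : ℝ, g (x + c.im * I) ≠ 0 := fun x => hgne _ (Or.inr (by simp))
    have hgd : Continuous (deriv g) := hg.deriv.continuous
    simp only [logDeriv_apply]
    exact (hgd.comp (by fun_prop)).div (hg.continuous.comp (by fun_prop)) hgn
  have hint : ∫ x in (c.re - 3 / 2)..c.re, logDeriv g (x + c.im * I) = G c - G (c - 3 / 2) := by
    rw [intervalIntegral.integral_eq_sub_of_hasDerivAt (f := fun x : ℝ => G (x + c.im * I)) ?_ hgi]
    · congr 2
      · simp
      · apply Complex.ext <;> simp
    · intro x hx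
      have d : HasDerivAt (fun x : ℝ => (x + c.im * I : ℂ)) 1 x := by
        simpa using (HasDerivAt.ofReal_comp (hasDerivAt_id x)).add_const (c.im * I)
      refine ((hG _ (hpt x hx)).comp x d).congr_deriv (mul_one _)
  have him : ∀ ρ ∈ Z, ρ.im ≠ c.im := fun ρ hρ h => hne ρ h (hZ ρ hρ).2
  have hi : ∀ ρ ∈ Z, IntervalIntegrable (fun x : ℝ => (m ρ : ℂ) * ((x : ℂ) + c.im * I - ρ)⁻¹)
      volume (c.re - 3 / 2) c.re := fun ρ hρ => by
    refine Continuous.intervalIntegrable (continuous_const.mul (Continuous.inv₀ (by fun_prop)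
      fun x h => him ρ hρ ?_)) _ _
    have := congrArg im h
    simp at this
    linarith
  have hsplit : ∫ x in (c.re - 3 / 2)..c.re, logDeriv f (x + c.im * I) =
      ∑ ρ ∈ Z, (m ρ : ℂ) * (∫ x in (c.re - 3 / 2)..c.re, ((x : ℂ) + c.im * I - ρ)⁻¹) +
        (G c - G (c - 3 / 2)) := by
    simp_rw [← intervalIntegral.integral_const_mul]
    rw [← hint, ← intervalIntegral.integral_finsetSum hi, ← intervalIntegral.integral_add]
    · refine intervalIntegral.integral_congr fun x _ => ?_
      refine logDeriv_eq_sum_add hg hfac (fun ρ hρ h => him ρ hρ ?_) (hgne _ (Or.inr (by simp)))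
      rw [← h]; simp
    · simpa [Finset.sum_fn] using IntervalIntegrable.sum Z hi
    · exact hgi
  rw [hsplit, add_im, im_sum]
  have hn : (n : ℝ) ≤ B / L := hcount
  have h1 : |∑ ρ ∈ Z, ((m ρ : ℂ) *
      ∫ x in (c.re - 3 / 2)..c.re, ((x : ℂ) + c.im * I - ρ)⁻¹).im| ≤ n * (2 * Real.pi) := by
    refine (Finset.abs_sum_le_sum_abs _ _).trans ?_
    simp only [n]
    push_cast
    rw [Finset.sum_mul]
    refine Finset.sum_le_sum fun ρ hρ => ?_
    rw [← ofReal_natCast, im_ofReal_mul, abs_mul, Nat.abs_cast]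
    gcongr
    exact abs_im_integral_horizontal_inv_sub_le (him ρ hρ)
  have h2 : |(G c - G (c - 3 / 2)).im| ≤ 12 * (A + 1) := by
    refine (abs_im_le_norm _).trans ?_
    rwa [norm_sub_rev]
  have h3 : n * (2 * Real.pi) + 12 * (n * Real.log 14) ≤
      B / L * (2 * Real.pi + 12 * Real.log 14) := by
    have : n * (2 * Real.pi) + 12 * (n * Real.log 14) =
      n * (2 * Real.pi + 12 * Real.log 14) := by ring
    rw [this]
    gcongr
  have h4 : 0 ≤ (2 * Real.pi + 12 * Real.log 14) / L := by positivity
  calc _ ≤ n * (2 * Real.pi) + 12 * (A + 1) := (abs_add_le _ _).trans (add_le_add h1 h2)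
    _ ≤ B / L * (2 * Real.pi + 12 * Real.log 14) + 12 * B + 12 := by rw [hA]; linarith
    _ = (2 * Real.pi + 12 * Real.log 14) / L * B + 12 * B + 12 := by ring
    _ ≤ _ := by nlinarith

/-! ### Stirling's approximation for the digamma function -/

/-- The terms of the Weierstrass series for the logarithm of the Gamma function. -/
noncomputable def logGammaTerm (j : ℕ) (w : ℂ) : ℂ :=
  (w - 1) * (Real.log ((j + 2) / (j + 1)) : ℂ) - log ((w + j) / (j + 1))

/-- The terms of the series for the digamma function. -/
noncomputable def digammaTerm (j : ℕ) (w : ℂ) : ℂ :=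
  (Real.log ((j + 2) / (j + 1)) : ℂ) - 1 / (w + j)

theorem hasDerivAt_logGammaTerm (j : ℕ) {w : ℂ} (hw : 0 < w.re) :
    HasDerivAt (logGammaTerm j) (digammaTerm j w) w := by
  have hj : (0 : ℝ) < j + 1 := by positivity
  have hj' : (j + 1 : ℂ) ≠ 0 := by exact_mod_cast hj.ne'
  have hre : 0 < ((w + j) / (j + 1)).re := by
    rw [show (j + 1 : ℂ) = ((j + 1 : ℝ) : ℂ) by push_cast; rfl, div_ofReal_re]
    have : 0 ≤ (j : ℝ) := j.cast_nonneg
    simp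
    positivity
  have hwj : w + j ≠ 0 := fun h => by rw [h] at hre; simp at hre
  have d : HasDerivAt (fun w : ℂ => (w + j) / (j + 1)) (1 / (j + 1)) w :=
    ((hasDerivAt_id w).add_const (j : ℂ)).div_const _
  refine ((((hasDerivAt_id w).sub_const 1).mul_const _).sub (d.clog (Or.inl hre))).congr_deriv ?_
  unfold digammaTerm
  field_simp

theorem abs_log_sub_inv_le (j : ℕ) :
    |Real.log ((j + 2) / (j + 1)) - 1 / (j + 1)| ≤ 1 / ((j : ℝ) + 1) ^ 2 := by
  have hj : (0 : ℝ) < j + 1 := by positivity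
  have h1 : Real.log ((j + 2) / (j + 1)) ≤ ((j : ℝ) + 2) / (j + 1) - 1 :=
    Real.log_le_sub_one_of_pos (by positivity)
  have h2 : 1 - (((j : ℝ) + 2) / (j + 1))⁻¹ ≤ Real.log ((j + 2) / (j + 1)) :=
    Real.one_sub_inv_le_log_of_pos (by positivity)
  have h3 : ((j : ℝ) + 2) / (j + 1) - 1 = 1 / (j + 1) := by field_simp; ring
  have h4 : 1 - (((j : ℝ) + 2) / (j + 1))⁻¹ = 1 / (j + 2) := by field_simp; ring
  have h5 : (1 : ℝ) / (j + 1) - 1 / ((j : ℝ) + 1) ^ 2 ≤ 1 / (j + 2) := by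
    rw [div_sub_div _ _ hj.ne' (by positivity), div_le_div_iff₀ (by positivity) (by positivity)]
    nlinarith [mul_pos hj hj]
  rw [abs_le]
  constructor
  · linarith
  · have : 0 ≤ 1 / ((j : ℝ) + 1) ^ 2 := by positivity
    linarith

/-- Both `log((j+2)/(j+1))` and `1/(w+j)` are `1/(j+1)` up to `O(1/j^2)`, uniformly for `w` bounded
with real part bounded below. This permits termwise differentiation of the logarithmic series. -/
theorem norm_digammaTerm_le (j : ℕ) {w : ℂ} {a B : ℝ} (ha : 0 < a) (ha1 : a ≤ 1) (hw : a < w.re)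
    (hB : ‖w‖ < B) : ‖digammaTerm j w‖ ≤ (1 + (B + 1) / a) * (1 / ((j : ℝ) + 1) ^ 2) := by
  have hj : (0 : ℝ) < j + 1 := by positivity
  have hj' : (j + 1 : ℂ) ≠ 0 := by exact_mod_cast hj.ne'
  have hre : a * (j + 1) ≤ ‖w + j‖ := by
    refine le_trans ?_ (re_le_norm _)
    have : 0 ≤ (j : ℝ) := j.cast_nonneg
    simp
    nlinarith
  have hpos : 0 < ‖w + j‖ := lt_of_lt_of_le (by positivity) hre
  have hwj : w + j ≠ 0 := norm_pos_iff.mp hpos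
  have h1 : digammaTerm j w = ((Real.log ((j + 2) / (j + 1)) - 1 / (j + 1) : ℝ) : ℂ) +
      (w - 1) / ((j + 1) * (w + j)) := by
    unfold digammaTerm
    push_cast
    field_simp
    ring
  have h2 : ‖w - 1‖ ≤ B + 1 := (norm_sub_le w 1).trans (by simp; linarith)
  have h3 : ‖(j + 1 : ℂ)‖ = j + 1 := by
    rw [show (j + 1 : ℂ) = ((j + 1 : ℝ) : ℂ) by push_cast; rfl, norm_real,
      Real.norm_of_nonneg hj.le]
  rw [h1]
  have hB0 : 0 ≤ B := (norm_nonneg w).trans hB.le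
  calc _ ≤ 1 / ((j : ℝ) + 1) ^ 2 + (B + 1) / ((j + 1) * (a * (j + 1))) := by
        refine (norm_add_le _ _).trans (add_le_add ?_ ?_)
        · rw [norm_real]; exact abs_log_sub_inv_le j
        · rw [norm_div, norm_mul, h3]
          gcongr
    _ = _ := by field_simp

theorem exp_sum_logGammaTerm {w : ℂ} (hw : 0 < w.re) (N : ℕ) :
    exp (∑ j ∈ Finset.range N, logGammaTerm j w) =
      ((N + 1 : ℕ) : ℂ) ^ (w - 1) * N.factorial / ∏ j ∈ Finset.range N, (w + j) := by
  induction N with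
  | zero => simp
  | succ N ih =>
    have hN : (0 : ℝ) < N + 1 := by positivity
    have hN' : (N + 1 : ℂ) ≠ 0 := by exact_mod_cast hN.ne'
    have hwN : w + N ≠ 0 := fun h => by
      have := congrArg re h
      have h0 : 0 ≤ (N : ℝ) := N.cast_nonneg
      simp at this
      linarith
    rw [Finset.sum_range_succ, exp_add, ih, Finset.prod_range_succ, logGammaTerm, exp_sub,
      exp_log (div_ne_zero hwN hN')]
    have h1 : ((N + 1 + 1 : ℕ) : ℂ) ^ (w - 1) = ((N + 1 : ℕ) : ℂ) ^ (w - 1) *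
        exp ((w - 1) * (Real.log ((N + 2) / (N + 1)) : ℂ)) := by
      rw [cpow_def_of_ne_zero (by exact_mod_cast (Nat.succ_ne_zero (N + 1))),
        cpow_def_of_ne_zero (by exact_mod_cast (Nat.succ_ne_zero N)), ← exp_add,
        Real.log_div (by positivity) hN.ne']
      congr 1
      rw [← natCast_log, ← natCast_log]
      push_cast
      ring_nf
    rw [h1, Nat.factorial_succ]
    push_cast
    field_simp

theorem tendsto_add_natCast_div (w : ℂ) :
    Tendsto (fun N : ℕ => (w + N) / (N + 1 : ℂ)) atTop (𝓝 1) := by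
  have h := (tendsto_one_div_add_atTop_nhds_zero_nat (𝕜 := ℂ)).const_mul (w - 1) |>.const_add 1
  rw [mul_zero, add_zero] at h
  refine h.congr fun N => ?_
  have hN : (N + 1 : ℂ) ≠ 0 := by exact_mod_cast Nat.succ_ne_zero N
  field_simp
  ring

/-- The exponentiated partial sum differs from Euler's sequence `GammaSeq w (N + 1)` by two factors
that tend to 1. -/
theorem tendsto_exp_sum_logGammaTerm {w : ℂ} (hw : 0 < w.re) :
    Tendsto (fun N : ℕ => exp (∑ j ∈ Finset.range N, logGammaTerm j w)) atTop (𝓝 (Gamma w)) := by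
  have h1 : ∀ N : ℕ, GammaSeq w (N + 1) * ((w + N) / (N + 1) * ((w + 1 + N) / (N + 1))) =
      exp (∑ j ∈ Finset.range N, logGammaTerm j w) := by
    intro N
    have hre : ∀ j : ℕ, w + j ≠ 0 := fun j h => by
      have := congrArg re h
      have h0 : 0 ≤ (j : ℝ) := j.cast_nonneg
      simp at this
      linarith
    have hN : ((N + 1 : ℕ) : ℂ) ≠ 0 := by exact_mod_cast Nat.succ_ne_zero N
    have hP : ∏ j ∈ Finset.range N, (w + j) ≠ 0 := Finset.prod_ne_zero_iff.mpr fun j _ => hre j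
    have hN1 := hre N
    have hN2 := hre (N + 1)
    rw [exp_sum_logGammaTerm hw, GammaSeq, Finset.prod_range_succ, Finset.prod_range_succ,
      Nat.factorial_succ, show w = w - 1 + 1 by ring, cpow_add _ _ hN, cpow_one,
      show w - 1 + 1 = w by ring]
    push_cast at hN hN2 ⊢
    field_simp
    ring
  have h2 := ((GammaSeq_tendsto_Gamma w).comp (tendsto_add_atTop_nat 1)).mul
    ((tendsto_add_natCast_div w).mul (tendsto_add_natCast_div (w + 1)))
  rw [mul_one, mul_one] at h2
  exact h2.congr h1

theorem summable_logGammaTerm_and_hasDerivAt {w : ℂ} (hw : 0 < w.re) :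
    Summable (fun j => logGammaTerm j w) ∧
      HasDerivAt (fun z => ∑' j, logGammaTerm j z) (∑' j, digammaTerm j w) w := by
  obtain ⟨a, ha, haw⟩ : ∃ a : ℝ, 0 < a ∧ a < min w.re 1 := exists_between (lt_min hw one_pos)
  have haw1 := haw.trans_le (min_le_left _ _)
  have ha1 := haw.trans_le (min_le_right _ _)
  set B := ‖w‖ + 2
  set t : Set ℂ := {z | a < z.re} ∩ Metric.ball 0 B
  have ht : IsOpen t := (isOpen_lt continuous_const continuous_re).inter Metric.isOpen_ball
  have htc : IsPreconnected t :=
    ((convex_halfSpace_re_gt a).inter (convex_ball 0 B)).isPreconnected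
  have hu : Summable fun j : ℕ => (1 + (B + 1) / a) * (1 / ((j : ℝ) + 1) ^ 2) := by
    refine Summable.mul_left _ ?_
    have := (summable_nat_add_iff 1).mpr (Real.summable_one_div_nat_pow.mpr one_lt_two)
    simpa using this
  have hg : ∀ (j : ℕ), ∀ z ∈ t, HasDerivAt (logGammaTerm j) (digammaTerm j z) z :=
    fun j z hz => hasDerivAt_logGammaTerm j (ha.trans hz.1)
  have hg' : ∀ (j : ℕ), ∀ z ∈ t, ‖digammaTerm j z‖ ≤ (1 + (B + 1) / a) * (1 / ((j : ℝ) + 1) ^ 2) :=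
    fun j z hz => norm_digammaTerm_le j ha ha1.le hz.1 (by simpa using hz.2)
  have h1t : (1 : ℂ) ∈ t := ⟨by simpa using ha1, by
    simp only [mem_ball_zero_iff, norm_one, B]; linarith [norm_nonneg w]⟩
  have hwt : w ∈ t := ⟨haw1, by simp [B]⟩
  -- Every term vanishes at 1, which anchors convergence; the derivative bounds on the convex region
  -- `t` propagate it to `w`.
  have hs : Summable fun j => logGammaTerm j 1 := by
    refine summable_zero.congr fun j => ?_
    have : (j + 1 : ℂ) ≠ 0 := by exact_mod_cast Nat.succ_ne_zero j
    simp [logGammaTerm, add_comm (1 : ℂ), this]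
  exact ⟨summable_of_summable_hasDerivAt_of_isPreconnected hu ht htc hg hg' h1t hs hwt,
    hasDerivAt_tsum_of_isPreconnected hu ht htc hg hg' h1t hs hwt⟩

theorem tendsto_sum_digammaTerm {w : ℂ} (hw : 0 < w.re) :
    Tendsto (fun N : ℕ => ∑ j ∈ Finset.range N, digammaTerm j w) atTop (𝓝 (digamma w)) := by
  have hexp : ∀ z : ℂ, 0 < z.re → Gamma z = exp (∑' j, logGammaTerm j z) := fun z hz =>
    tendsto_nhds_unique (tendsto_exp_sum_logGammaTerm hz)
      ((continuous_exp.tendsto _).comp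
        (summable_logGammaTerm_and_hasDerivAt hz).1.hasSum.tendsto_sum_nat)
  have hev : Gamma =ᶠ[𝓝 w] fun z => exp (∑' j, logGammaTerm j z) := by
    filter_upwards [(isOpen_lt continuous_const continuous_re).mem_nhds hw] with z hz
    exact hexp z hz
  have hd : digamma w = ∑' j, digammaTerm j w := by
    rw [digamma_def, logDeriv_apply, hev.deriv_eq, hexp w hw,
      (summable_logGammaTerm_and_hasDerivAt hw).2.cexp.deriv]
    field_simp
  have hsum : Summable fun j => digammaTerm j w := by
    obtain ⟨a, ha, haw⟩ : ∃ a : ℝ, 0 < a ∧ a < min w.re 1 := exists_between (lt_min hw one_pos)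
    have haw1 := haw.trans_le (min_le_left _ _)
    have ha1 := haw.trans_le (min_le_right _ _)
    refine Summable.of_norm_bounded (g := fun j : ℕ =>
      (1 + (‖w‖ + 1 + 1) / a) * (1 / ((j : ℝ) + 1) ^ 2)) (Summable.mul_left _ ?_)
      fun j => norm_digammaTerm_le j ha ha1.le haw1 (by linarith)
    have := (summable_nat_add_iff 1).mpr (Real.summable_one_div_nat_pow.mpr one_lt_two)
    simpa using this
  rw [hd]
  exact hsum.hasSum.tendsto_sum_nat

/-- Apply the mean value inequality to `u ↦ log(z + u) - u/z` on `[0, 1]`, where `z = w + j`: its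
derivative is at most `1/|z|^2`, and `(j + im w)^2 ≤ 2 |z|^2`. -/
theorem norm_log_add_one_sub_log_sub_inv_le {w : ℂ} (hre : 0 < w.re) (him : 0 < w.im) (j : ℕ) :
    ‖log (w + j + 1) - log (w + j) - 1 / (w + j)‖ ≤ 2 / ((j : ℝ) + w.im) ^ 2 := by
  have hj : 0 ≤ (j : ℝ) := j.cast_nonneg
  set z := w + j with hz
  have hzre : 0 < z.re := by simp [hz]; positivity
  have hz0 : 0 < ‖z‖ := hzre.trans_le (re_le_norm z)
  have hne : z ≠ 0 := norm_pos_iff.mp hz0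
  have hmono : ∀ u ∈ Icc (0 : ℝ) 1, ‖z‖ ≤ ‖z + u‖ := by
    intro u hu
    rw [← sq_le_sq₀ (norm_nonneg _) (norm_nonneg _), Complex.sq_norm, Complex.sq_norm,
      normSq_apply, normSq_apply]
    simp only [add_re, ofReal_re, add_im, ofReal_im, add_zero]
    nlinarith [hu.1]
  have hd : ∀ u ∈ Icc (0 : ℝ) 1, HasDerivWithinAt (fun u : ℝ => log (z + u) - u * (1 / z))
      (1 / (z + u) - 1 / z) (Icc 0 1) u := by
    intro u hu
    have d : HasDerivAt (fun u : ℝ => z + (u : ℂ)) 1 u :=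
      (HasDerivAt.ofReal_comp (hasDerivAt_id u)).const_add z
    have d2 : HasDerivAt (fun u : ℝ => (u : ℂ) * (1 / z)) (1 * (1 / z)) u :=
      (HasDerivAt.ofReal_comp (hasDerivAt_id u)).mul_const _
    have hs : z + u ∈ slitPlane := Or.inl (by simp; linarith [hu.1])
    have := (d.clog_real hs).sub d2
    rw [one_mul] at this
    exact this.hasDerivWithinAt
  have hb : ∀ u ∈ Ico (0 : ℝ) 1, ‖1 / (z + u) - 1 / z‖ ≤ 1 / ‖z‖ ^ 2 := by
    intro u hu
    have h1 := hmono u ⟨hu.1, hu.2.le⟩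
    have hne' : z + u ≠ 0 := norm_pos_iff.mp (hz0.trans_le h1)
    have h2 : 1 / (z + u) - 1 / z = -u / ((z + u) * z) := by field_simp; ring
    rw [h2, norm_div, norm_neg, norm_mul, norm_real, Real.norm_of_nonneg hu.1, sq]
    gcongr
    exact hu.2.le
  have := norm_image_sub_le_of_norm_deriv_le_segment_01' hd hb
  simp only [ofReal_one, ofReal_zero, one_mul, zero_mul, sub_zero, add_zero] at this
  rw [show log (z + 1) - 1 / z - log z = log (z + 1) - log z - 1 / z by ring] at this
  refine this.trans ?_
  have hsq : ((j : ℝ) + w.im) ^ 2 ≤ 2 * ‖z‖ ^ 2 := by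
    rw [Complex.sq_norm, normSq_apply]
    simp only [hz, add_re, natCast_re, add_im, natCast_im, add_zero]
    nlinarith [sq_nonneg ((j : ℝ) - w.im), mul_nonneg hre.le hj, mul_pos hre hre]
  rw [div_le_div_iff₀ (by positivity) (by positivity)]
  linarith

/-- The terms after the first telescope to at most `2/t`; the first is at most `4/t` because `1/2 ≤
t`. -/
theorem sum_two_div_sq_le {t : ℝ} (ht : 1 / 2 ≤ t) (N : ℕ) :
    ∑ j ∈ Finset.range N, 2 / ((j : ℝ) + t) ^ 2 ≤ 6 / t := by
  have ht0 : 0 < t := by linarith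
  have h : ∀ N : ℕ, ∑ j ∈ Finset.range (N + 1), 2 / ((j : ℝ) + t) ^ 2 ≤
      2 / t ^ 2 + 2 / t - 2 / (N + t) := by
    intro N
    induction N with
    | zero => simp
    | succ N ih =>
      rw [Finset.sum_range_succ]
      have hN : 0 ≤ (N : ℝ) := N.cast_nonneg
      have : 2 / (((N + 1 : ℕ) : ℝ) + t) ^ 2 ≤ 2 / (N + t) - 2 / (((N + 1 : ℕ) : ℝ) + t) := by
        push_cast
        rw [div_sub_div _ _ (by positivity) (by positivity),
          div_le_div_iff₀ (by positivity) (by positivity)]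
        nlinarith [mul_pos ht0 ht0, mul_nonneg hN ht0.le]
      linarith
  have h2 : 2 / t ^ 2 ≤ 4 / t := by
    rw [div_le_div_iff₀ (by positivity) ht0]
    nlinarith
  cases N with
  | zero => simp; positivity
  | succ N =>
    refine (h N).trans ?_
    have h3 : 0 ≤ 2 / ((N : ℝ) + t) := by positivity
    have h4 : 6 / t = 4 / t + 2 / t := by ring
    linarith

/-- Stirling's approximation for the digamma function away from the real axis. -/
theorem norm_digamma_sub_log_le {w : ℂ} (hre : 0 < w.re) (him : 1 / 2 ≤ w.im) :
    ‖digamma w - log w‖ ≤ 6 / w.im := by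
  have him0 : 0 < w.im := by linarith
  have hlog : Tendsto (fun N : ℕ => log ((w + N) / (N + 1 : ℂ))) atTop (𝓝 0) := by
    have := (continuousAt_clog (x := 1) (by simp)).tendsto.comp (tendsto_add_natCast_div w)
    rwa [log_one] at this
  have hlim := (((tendsto_sum_digammaTerm hre).sub_const (log w)).add hlog).norm
  rw [add_zero] at hlim
  refine le_of_tendsto hlim (Eventually.of_forall fun N => ?_)
  -- The correction `log((w + N)/(N + 1))`, which tends to 0, turns the partial sum into a
  -- telescoping one whose terms are the quadratically small differences already bounded.
  have hsum : ∀ N : ℕ, ∑ j ∈ Finset.range N, digammaTerm j w - log w + log ((w + N) / (N + 1 : ℂ)) =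
      ∑ j ∈ Finset.range N, (log (w + j + 1) - log (w + j) - 1 / (w + j)) := by
    intro N
    have h1 : (Real.log (N + 1) : ℂ) + log ((w + N) / (N + 1 : ℂ)) = log (w + N) := by
      have hN : (0 : ℝ) < N + 1 := by positivity
      have hwN : w + N ≠ 0 := fun h => by
        have := congrArg im h
        simp at this
        linarith
      have hN' : (N + 1 : ℂ) ≠ 0 := by exact_mod_cast hN.ne'
      rw [← log_ofReal_mul hN (div_ne_zero hwN hN')]
      congr 1
      push_cast
      field_simp
    have h2 : ∑ j ∈ Finset.range N, (Real.log ((j + 2) / (j + 1)) : ℂ) = (Real.log (N + 1) : ℂ) := by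
      have := Finset.sum_range_sub (fun j : ℕ => (Real.log ((j : ℝ) + 1) : ℂ)) N
      simp only [Nat.cast_zero, zero_add, Real.log_one, ofReal_zero, sub_zero] at this
      rw [← this]
      refine Finset.sum_congr rfl fun j _ => ?_
      rw [Real.log_div (by positivity) (by positivity)]
      push_cast
      ring_nf
    have h3 : ∑ j ∈ Finset.range N, (log (w + j + 1) - log (w + j)) = log (w + N) - log w := by
      have := Finset.sum_range_sub (fun j : ℕ => log (w + j)) N
      simpa [add_assoc] using this
    simp only [digammaTerm]
    rw [Finset.sum_sub_distrib, h2, Finset.sum_sub_distrib, h3, ← h1]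
    ring
  rw [hsum]
  refine (norm_sum_le _ _).trans ((Finset.sum_le_sum fun j _ =>
    norm_log_add_one_sub_log_sub_inv_le hre him0 j).trans (sum_two_div_sq_le him N))

/-! ### The xi-function: symmetries, zeros and logarithmic derivative -/

/-- The entire function `s (s - 1) Λ(s)`, twice the Riemann xi-function. -/
noncomputable def xiFun (s : ℂ) : ℂ := s * (s - 1) * completedRiemannZeta₀ s + 1

theorem differentiable_xiFun : Differentiable ℂ xiFun := by
  have := differentiable_completedZeta₀
  unfold xiFun
  fun_prop

theorem xiFun_one_sub (s : ℂ) : xiFun (1 - s) = xiFun s := by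
  rw [xiFun, xiFun, completedRiemannZeta₀_one_sub]
  ring

theorem ne_zero_of_im_ne_zero {s : ℂ} (h : s.im ≠ 0) : s ≠ 0 := by
  rintro rfl
  simp at h

theorem ne_one_of_im_ne_zero {s : ℂ} (h : s.im ≠ 0) : s ≠ 1 := by
  rintro rfl
  simp at h

theorem Gammaℝ_ne_zero_of_im_ne_zero {s : ℂ} (h : s.im ≠ 0) : Gammaℝ s ≠ 0 := by
  intro h'
  obtain ⟨n, hn⟩ := Gammaℝ_eq_zero_iff.mp h'
  rw [hn] at h
  simp at h

theorem xiFun_eq_mul_riemannZeta {s : ℂ} (h : s.im ≠ 0) :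
    xiFun s = s * (s - 1) * Gammaℝ s * riemannZeta s := by
  have h0 := ne_zero_of_im_ne_zero h
  have h1 := sub_ne_zero.mpr (ne_one_of_im_ne_zero h)
  have h1' : 1 - s ≠ 0 := sub_ne_zero.mpr (ne_one_of_im_ne_zero h).symm
  have hG := Gammaℝ_ne_zero_of_im_ne_zero h
  have e : (1 - s) = -(s - 1) := by ring
  rw [riemannZeta_def_of_ne_zero h0, completedRiemannZeta_eq, xiFun, e]
  field_simp
  ring

theorem xiFun_eq_zero_iff {s : ℂ} (h : s.im ≠ 0) : xiFun s = 0 ↔ riemannZeta s = 0 := by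
  rw [xiFun_eq_mul_riemannZeta h, mul_eq_zero, or_iff_right]
  exact mul_ne_zero (mul_ne_zero (ne_zero_of_im_ne_zero h)
    (sub_ne_zero.mpr (ne_one_of_im_ne_zero h))) (Gammaℝ_ne_zero_of_im_ne_zero h)

theorem analyticAt_Gammaℝ {s : ℂ} (h : s.im ≠ 0 ∨ 0 < s.re) : AnalyticAt ℂ Gammaℝ s := by
  have hU : IsOpen {z : ℂ | z.im ≠ 0 ∨ 0 < z.re} :=
    (isOpen_ne_fun continuous_im continuous_const).union (isOpen_lt continuous_const continuous_re)
  refine (DifferentiableOn.analyticOnNhd (fun z hz => ?_) hU) s h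
  have hne : ∀ m : ℕ, z / 2 ≠ -m := by
    intro m hm
    have hz2 : z = -(2 * m) := by linear_combination 2 * hm
    rcases hz with hz | hz
    · rw [hz2] at hz; simp at hz
    · rw [hz2] at hz
      simp at hz
      have : (0 : ℝ) ≤ m := m.cast_nonneg
      linarith
  have h1 : DifferentiableAt ℂ (fun z : ℂ => Gamma (z / 2)) z :=
    (differentiableAt_Gamma _ hne).comp z (by fun_prop)
  have h2 : DifferentiableAt ℂ (fun z : ℂ => (Real.pi : ℂ) ^ (-z / 2)) z :=
    DifferentiableAt.const_cpow (by fun_prop) (Or.inl (by exact_mod_cast Real.pi_ne_zero))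
  have h3 : Gammaℝ = fun z : ℂ => (Real.pi : ℂ) ^ (-z / 2) * Gamma (z / 2) := funext Gammaℝ_def
  rw [h3]
  exact (h2.mul h1).differentiableWithinAt

/-- Off the real axis the factor relating the two functions is analytic and nonvanishing, so
counting zeros of xi counts zeros of zeta with the right multiplicities. -/
theorem analyticOrderNatAt_xiFun {s : ℂ} (h : s.im ≠ 0) :
    analyticOrderNatAt xiFun s = analyticOrderNatAt riemannZeta s := by
  have hev : xiFun =ᶠ[𝓝 s] (fun s => s * (s - 1) * Gammaℝ s) * riemannZeta := by
    filter_upwards [(isOpen_ne_fun continuous_im continuous_const).mem_nhds h] with z hz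
    exact xiFun_eq_mul_riemannZeta hz
  have h1 : AnalyticAt ℂ (fun s => s * (s - 1) * Gammaℝ s) s :=
    (analyticAt_id.mul (analyticAt_id.sub analyticAt_const)).mul (analyticAt_Gammaℝ (Or.inl h))
  have h2 : AnalyticAt ℂ riemannZeta s := analyticOn_riemannZeta s (ne_one_of_im_ne_zero h)
  have h3 : analyticOrderAt (fun s => s * (s - 1) * Gammaℝ s) s = 0 :=
    h1.analyticOrderAt_eq_zero.mpr (mul_ne_zero (mul_ne_zero (ne_zero_of_im_ne_zero h)
      (sub_ne_zero.mpr (ne_one_of_im_ne_zero h))) (Gammaℝ_ne_zero_of_im_ne_zero h))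
  rw [analyticOrderNatAt, analyticOrderNatAt, analyticOrderAt_congr hev,
    analyticOrderAt_mul h1 h2, h3, zero_add]

theorem Gammaℝ_conj (s : ℂ) : Gammaℝ (conj s) = conj (Gammaℝ s) := by
  have hπ : (Real.pi : ℂ) ^ (-conj s / 2) = conj ((Real.pi : ℂ) ^ (-s / 2)) := by
    have := cpow_conj (Real.pi : ℂ) (-s / 2)
      (by rw [arg_ofReal_of_nonneg Real.pi_pos.le]; exact Real.pi_ne_zero.symm)
    rw [conj_ofReal] at this
    rw [← this, map_div₀, map_neg, map_ofNat]
  rw [Gammaℝ_def, Gammaℝ_def, map_mul, ← Gamma_conj, hπ, map_div₀, map_ofNat]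

theorem xiFun_conj {s : ℂ} (h : s.im ≠ 0) : xiFun (conj s) = conj (xiFun s) := by
  rw [xiFun_eq_mul_riemannZeta h, xiFun_eq_mul_riemannZeta (by simpa using h), Gammaℝ_conj,
    riemannZeta_conj]
  simp

/-- Combines the functional equation with conjugation, that is, reflection in the critical line. It
folds the left half of the contour onto the right half. -/
theorem logDeriv_xiFun_one_sub_conj {s : ℂ} (h : s.im ≠ 0) :
    logDeriv xiFun (1 - conj s) = -conj (logDeriv xiFun s) := by
  have h1 : deriv xiFun (1 - conj s) = -deriv xiFun (conj s) := by
    have hd : HasDerivAt (fun z => xiFun (1 - z)) (-deriv xiFun (1 - conj s)) (conj s) := by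
      have := (differentiable_xiFun (1 - conj s)).hasDerivAt.comp (conj s)
        ((hasDerivAt_id (conj s)).const_sub 1)
      simpa [Function.comp_def] using this
    have hfun : (fun z => xiFun (1 - z)) = xiFun := funext xiFun_one_sub
    rw [hfun] at hd
    rw [hd.deriv, neg_neg]
  have h2 : deriv xiFun (conj s) = conj (deriv xiFun s) := by
    have hd := (differentiable_xiFun s).hasDerivAt.conj_conj
    refine HasDerivAt.deriv (hd.congr_of_eventuallyEq ?_)
    have hc : (conj s).im ≠ 0 := by simpa using h
    filter_upwards [(isOpen_ne_fun continuous_im continuous_const).mem_nhds hc] with z hz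
    have := xiFun_conj hz
    simp [this]
  rw [logDeriv_apply, logDeriv_apply, h1, h2, xiFun_one_sub, xiFun_conj h, map_div₀, neg_div]

/-- Zeros of the zeta-function in the open upper half-plane lie in the critical strip. -/
theorem re_mem_Ioo_of_riemannZeta_eq_zero {s : ℂ} (h : s.im ≠ 0) (hz : riemannZeta s = 0) :
    s.re ∈ Ioo (0 : ℝ) 1 := by
  have key : ∀ z : ℂ, z.im ≠ 0 → riemannZeta z = 0 → z.re < 1 := fun z _ hz0 => by
    by_contra hre
    exact riemannZeta_ne_zero_of_one_le_re (not_lt.mp hre) hz0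
  have h' : (1 - s).im ≠ 0 := by simpa using h
  have hz' : riemannZeta (1 - s) = 0 := by
    rw [← xiFun_eq_zero_iff h', xiFun_one_sub, xiFun_eq_zero_iff h, hz]
  have := key (1 - s) h' hz'
  rw [sub_re, one_re] at this
  exact ⟨by linarith, key s h hz⟩

theorem three_halves_lt_im_of_riemannZeta_eq_zero {s : ℂ} (h : 0 < s.im) (hz : riemannZeta s = 0) :
    3 / 2 < s.im := by
  by_contra hle
  have hre := re_mem_Ioo_of_riemannZeta_eq_zero h.ne' hz
  exact riemannZeta_ne_zero_of_abs_im_le hre.1.le hre.2.le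
    (by rw [abs_of_pos h]; exact not_lt.mp hle) hz

theorem riemannZeta₁_eq_mul {s : ℂ} (hs : s ≠ 1) : riemannZeta₁ s = (s - 1) * riemannZeta s := by
  have := sub_ne_zero.mpr hs
  rw [riemannZeta_eq_inv_sub_mul hs]
  field_simp

/-- Absorbing `s - 1` into zeta leaves an entire function, to which the argument estimate for entire
functions applies. -/
theorem logDeriv_xiFun {s : ℂ} (hre : 0 < s.re) (him : s.im ≠ 0) (hz : riemannZeta s ≠ 0) :
    logDeriv xiFun s =
      1 / s - Real.log Real.pi / 2 + digamma (s / 2) / 2 + logDeriv riemannZeta₁ s := by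
  have h0 := ne_zero_of_im_ne_zero him
  have hz1 : riemannZeta₁ s ≠ 0 := by
    rw [riemannZeta₁_eq_mul (ne_one_of_im_ne_zero him)]
    exact mul_ne_zero (sub_ne_zero.mpr (ne_one_of_im_ne_zero him)) hz
  have hπ : (Real.pi : ℂ) ≠ 0 := by exact_mod_cast Real.pi_ne_zero
  have hπs : (Real.pi : ℂ) ^ (-s / 2) ≠ 0 := by simp [cpow_eq_zero_iff, hπ]
  have hre2 : 0 < (s / 2).re := by simpa using hre
  have hG : Gamma (s / 2) ≠ 0 := Gamma_ne_zero_of_re_pos hre2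
  have hev : xiFun =ᶠ[𝓝 s]
      fun s => s * ((Real.pi : ℂ) ^ (-s / 2) * Gamma (s / 2)) * riemannZeta₁ s := by
    filter_upwards [(isOpen_ne_fun continuous_im continuous_const).mem_nhds him] with z hz
    rw [xiFun_eq_mul_riemannZeta hz, riemannZeta₁_eq_mul (ne_one_of_im_ne_zero hz), Gammaℝ_def]
    ring
  have dπ : HasDerivAt (fun s : ℂ => (Real.pi : ℂ) ^ (-s / 2))
      ((Real.pi : ℂ) ^ (-s / 2) * log Real.pi * (-1 / 2)) s :=
    HasDerivAt.const_cpow ((hasDerivAt_id s).neg.div_const 2) (Or.inl hπ)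
  have dG : HasDerivAt (fun s : ℂ => Gamma (s / 2)) (deriv Gamma (s / 2) * (1 / 2)) s := by
    have hd : DifferentiableAt ℂ Gamma (s / 2) := differentiableAt_Gamma _ fun m hm => by
      rw [hm] at hre2
      simp at hre2
      have : (0 : ℝ) ≤ m := m.cast_nonneg
      linarith
    exact hd.hasDerivAt.comp s ((hasDerivAt_id s).div_const 2)
  have hdz := differentiable_riemannZeta₁ s
  have e1 := logDeriv_mul (f := fun z : ℂ => (Real.pi : ℂ) ^ (-z / 2))
    (g := fun z : ℂ => Gamma (z / 2)) s hπs hG dπ.differentiableAt dG.differentiableAt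
  have e2 := logDeriv_mul (f := fun z : ℂ => z)
    (g := fun z : ℂ => (Real.pi : ℂ) ^ (-z / 2) * Gamma (z / 2)) s h0 (mul_ne_zero hπs hG)
    differentiableAt_fun_id (dπ.differentiableAt.mul dG.differentiableAt)
  have e3 := logDeriv_mul
    (f := fun z : ℂ => z * ((Real.pi : ℂ) ^ (-z / 2) * Gamma (z / 2))) (g := riemannZeta₁) s
    (mul_ne_zero h0 (mul_ne_zero hπs hG)) hz1
    (differentiableAt_fun_id.mul (dπ.differentiableAt.mul dG.differentiableAt)) hdz
  have e4 : logDeriv xiFun s =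
      logDeriv (fun s => s * ((Real.pi : ℂ) ^ (-s / 2) * Gamma (s / 2)) * riemannZeta₁ s) s := by
    rw [logDeriv_apply, logDeriv_apply, hev.deriv_eq, hev.self_of_nhds]
  rw [e4, e3, e2, e1, logDeriv_apply (fun z : ℂ => z),
    logDeriv_apply (fun z : ℂ => (Real.pi : ℂ) ^ (-z / 2)), dπ.deriv,
    logDeriv_apply (fun z : ℂ => Gamma (z / 2)), dG.deriv, digamma_def, logDeriv_apply Gamma,
    ofReal_log Real.pi_pos.le]
  simp only [deriv_id'']
  field_simp
  ring

/-! ### The Riemann–von Mangoldt formula -/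

/-- The number of zeros `ρ = β + iγ` of the zeta-function with `0 < γ < x`, with multiplicity. -/
noncomputable def zetaCount (x : ℝ) : ℝ :=
  ∑ ρ ∈ (zetaZerosBelow_finite x).toFinset, (analyticOrderNatAt riemannZeta ρ : ℝ)

/-- The bottom edge at height 1 lies below every zero counted, since ordinates exceed `3/2`. -/
theorem rectIntegral_logDeriv_xiFun {T : ℝ} (hT : 1 ≤ T)
    (hne : ∀ z : ℂ, z.im = T → riemannZeta z ≠ 0) :
    rectIntegral (logDeriv xiFun) (-1) 2 1 T = 2 * Real.pi * I * zetaCount T := by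
  rw [rectIntegral_logDeriv differentiable_xiFun (by norm_num) hT
    (Z := (zetaZerosBelow_finite T).toFinset), zetaCount]
  · push_cast
    congr 1
    refine Finset.sum_congr rfl fun ρ hρ => ?_
    have h := (zetaZerosBelow_finite T).mem_toFinset.mp hρ
    rw [analyticOrderNatAt_xiFun h.2.1.ne']
  · intro ρ hρ
    obtain ⟨hz, h0, h1⟩ := (zetaZerosBelow_finite T).mem_toFinset.mp hρ
    have hre := re_mem_Ioo_of_riemannZeta_eq_zero h0.ne' hz
    have him := three_halves_lt_im_of_riemannZeta_eq_zero h0 hz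
    exact ⟨by linarith [hre.1], by linarith [hre.2], by linarith, h1⟩
  · intro z hz h0
    rw [mem_reProdIm] at hz
    have him : 0 < z.im := by linarith [hz.2.1]
    have hz0 := (xiFun_eq_zero_iff him.ne').mp h0
    exact (zetaZerosBelow_finite T).mem_toFinset.mpr
      ⟨hz0, him, lt_of_le_of_ne hz.2.2 fun h => hne z h hz0⟩

/-- The Dirichlet series without its first term is dominated by `π²/6 - 1 < 2/3`. Zeta therefore has
positive real part on `re s = 2`, where its principal logarithm is available. -/
theorem norm_riemannZeta_two_sub_one_le {s : ℂ} (hs : s.re = 2) : ‖riemannZeta s - 1‖ ≤ 2 / 3 := by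
  have h1 : 1 < s.re := by rw [hs]; norm_num
  have hsm : Summable fun n : ℕ => 1 / ((n : ℂ) + 1) ^ s := by
    have := (summable_nat_add_iff 1).mpr (Complex.summable_one_div_nat_cpow.mpr h1)
    simpa using this
  have hr : HasSum (fun n : ℕ => 1 / ((n : ℝ) + 1) ^ 2) (Real.pi ^ 2 / 6) := by
    have := (hasSum_nat_add_iff' 1).mpr hasSum_zeta_two
    simpa using this
  have hr1 : HasSum (fun n : ℕ => 1 / ((n : ℝ) + 2) ^ 2) (Real.pi ^ 2 / 6 - 1) := by
    have := (hasSum_nat_add_iff' 1).mpr hr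
    simp only [Finset.range_one, Finset.sum_singleton, Nat.cast_zero] at this
    have e : ∀ n : ℕ, 1 / ((n : ℝ) + 2) ^ 2 = 1 / (((n + 1 : ℕ) : ℝ) + 1) ^ 2 := fun n => by
      push_cast; ring
    simp_rw [e]
    simpa using this
  rw [zeta_eq_tsum_one_div_nat_add_one_cpow h1, hsm.tsum_eq_zero_add]
  simp only [Nat.cast_zero, zero_add, one_cpow, div_one, add_sub_cancel_left]
  refine (tsum_of_norm_bounded hr1 fun n => ?_).trans ?_
  · have hc : ((n + 1 : ℕ) : ℂ) + 1 = ((n + 2 : ℕ) : ℂ) := by push_cast; ring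
    rw [norm_div, norm_one, hc, norm_natCast_cpow_of_pos (by omega), hs]
    push_cast
    norm_num
  · have := Real.pi_lt_d2
    nlinarith [Real.pi_pos]

theorem riemannZeta_re_pos_of_re_eq_two {s : ℂ} (hs : s.re = 2) : 1 / 3 ≤ (riemannZeta s).re := by
  have h1 := (abs_re_le_norm _).trans (norm_riemannZeta_two_sub_one_le hs)
  rw [sub_re, one_re, abs_le] at h1
  linarith [h1.1]

theorem continuousOn_digamma : ContinuousOn digamma {z : ℂ | 0 < z.re} := by
  have hU : IsOpen {z : ℂ | 0 < z.re} := isOpen_lt continuous_const continuous_re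
  have hd : DifferentiableOn ℂ Gamma {z : ℂ | 0 < z.re} := fun z hz =>
    (differentiableAt_Gamma z fun m hm => by
      have hz' : 0 < z.re := hz
      rw [hm] at hz'
      simp at hz'
      have : (0 : ℝ) ≤ m := m.cast_nonneg
      linarith).differentiableWithinAt
  exact (hd.deriv hU).continuousOn.div hd.continuousOn fun z hz => Gamma_ne_zero_of_re_pos hz

theorem continuousOn_logDeriv {f : ℂ → ℂ} (hf : Differentiable ℂ f) :
    ContinuousOn (logDeriv f) {z | f z ≠ 0} :=
  hf.deriv.continuous.continuousOn.div hf.continuous.continuousOn fun _ h => h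

/-- Bound for the variation of the argument of the xi-function on a horizontal half-segment. -/
theorem exists_abs_im_integral_logDeriv_xiFun_le :
    ∃ C : ℝ, ∀ T : ℝ, 3 / 2 ≤ T → (∀ z : ℂ, z.im = T → riemannZeta z ≠ 0) →
      |(∫ x in (1 / 2 : ℝ)..2, logDeriv xiFun (x + T * I)).im| ≤ C * (1 + Real.log T) := by
  obtain ⟨C, hC, hback⟩ := exists_abs_im_integral_logDeriv_le
  refine ⟨30 + 30 * C, fun T hT hne => ?_⟩
  have hT0 : 0 < T := by linarith
  have hlogT : 0 ≤ Real.log T := Real.log_nonneg (by linarith)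
  set c : ℂ := 2 + T * I with hc
  have hcre : c.re = 2 := by simp [hc]
  have hcim : c.im = T := by simp [hc]
  have hne1 : ∀ z : ℂ, z.im = T → riemannZeta₁ z ≠ 0 := fun z hz => by
    have h0 : z.im ≠ 0 := by rw [hz]; exact hT0.ne'
    rw [riemannZeta₁_eq_mul (ne_one_of_im_ne_zero h0)]
    exact mul_ne_zero (sub_ne_zero.mpr (ne_one_of_im_ne_zero h0)) (hne z hz)
  have hfc : 1 / 2 ≤ ‖riemannZeta₁ c‖ := by
    rw [riemannZeta₁_eq_mul (ne_one_of_im_ne_zero (by rw [hcim]; exact hT0.ne')), norm_mul]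
    have h1 : T ≤ ‖c - 1‖ := by
      have := abs_im_le_norm (c - 1)
      rw [sub_im, hcim, one_im, sub_zero, abs_of_pos hT0] at this
      exact this
    have h2 : 1 / 3 ≤ ‖riemannZeta c‖ :=
      (riemannZeta_re_pos_of_re_eq_two hcre).trans (re_le_norm _)
    nlinarith
  -- The disc of radius `15/8` about `2 + iT` stays in `re s ≥ 1/8`, where the cubic bound for `(s -
  -- 1)ζ(s)` holds with `1 + ‖z‖ ≤ T + 5`.
  have hz := hback riemannZeta₁ c (2 * (T + 5) ^ 3) differentiable_riemannZeta₁
    (by nlinarith [pow_pos (show 0 < T + 5 by linarith) 2]) ?_ (by rwa [hcim])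
  · rw [hcre, hcim] at hz
    norm_num at hz
    have hlog : Real.log (2 * (T + 5) ^ 3 / ‖riemannZeta₁ c‖) ≤ 3 * Real.log T + 8 := by
      have h1 : 2 * (T + 5) ^ 3 / ‖riemannZeta₁ c‖ ≤ T ^ 3 * Real.exp 8 := by
        rw [div_le_iff₀ (by linarith)]
        -- Dividing by `‖riemannZeta₁ c‖ ≥ 1/2` and using `T + 5 ≤ 5T` gives `4 · 125 T^3 = 500
        -- T^3`.
        have he : (500 : ℝ) ≤ Real.exp 8 := by
          have h3 := Real.exp_one_gt_d9
          have : Real.exp 8 = Real.exp 1 ^ 8 := by rw [← Real.exp_nat_mul]; norm_num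
          rw [this]
          calc (500 : ℝ) ≤ 2.7 ^ 8 := by norm_num
            _ ≤ _ := by gcongr; linarith
        have h5 : (T + 5) ^ 3 ≤ (5 * T) ^ 3 := by gcongr; linarith
        have h6 : 0 < T ^ 3 := by positivity
        nlinarith [mul_le_mul_of_nonneg_left he h6.le, mul_pos h6 (Real.exp_pos 8)]
      have h2 : 0 < 2 * (T + 5) ^ 3 / ‖riemannZeta₁ c‖ := by positivity
      refine (Real.log_le_log h2 h1).trans_eq ?_
      rw [Real.log_mul (by positivity) (Real.exp_pos 8).ne', Real.log_pow, Real.log_exp]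
      norm_num
    have hpt : ∀ x ∈ uIcc (1 / 2 : ℝ) 2, 0 < (x + T * I : ℂ).re ∧ (x + T * I : ℂ).im = T := by
      intro x hx
      rw [uIcc_of_le (by norm_num)] at hx
      refine ⟨?_, by simp⟩
      simp
      linarith [hx.1]
    have hi1 : IntervalIntegrable (fun x : ℝ => 1 / (x + T * I : ℂ)) volume (1 / 2) 2 := by
      refine ContinuousOn.intervalIntegrable (ContinuousOn.div (by fun_prop) (by fun_prop) ?_)
      exact fun x hx => ne_zero_of_im_ne_zero (by rw [(hpt x hx).2]; exact hT0.ne')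
    have hi2 : IntervalIntegrable (fun x : ℝ => digamma ((x + T * I) / 2)) volume (1 / 2) 2 := by
      refine ContinuousOn.intervalIntegrable (continuousOn_digamma.comp (by fun_prop) ?_)
      intro x hx
      have := (hpt x hx).1
      simpa using this
    have hi3 : IntervalIntegrable (fun x : ℝ => logDeriv riemannZeta₁ (x + T * I)) volume
        (1 / 2) 2 := by
      refine ContinuousOn.intervalIntegrable
        ((continuousOn_logDeriv differentiable_riemannZeta₁).comp (by fun_prop) ?_)
      exact fun x hx => hne1 _ (hpt x hx).2
    have hsplit : ∫ x in (1 / 2 : ℝ)..2, logDeriv xiFun (x + T * I) =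
        (∫ x in (1 / 2 : ℝ)..2, 1 / (x + T * I : ℂ)) -
        (∫ x in (1 / 2 : ℝ)..2, ((Real.log Real.pi / 2 : ℝ) : ℂ)) +
        (∫ x in (1 / 2 : ℝ)..2, digamma ((x + T * I) / 2)) / 2 +
        ∫ x in (1 / 2 : ℝ)..2, logDeriv riemannZeta₁ (x + T * I) := by
      rw [← intervalIntegral.integral_div, ← intervalIntegral.integral_sub hi1 (by simp),
        ← intervalIntegral.integral_add (hi1.sub (by simp)) (hi2.div_const 2),
        ← intervalIntegral.integral_add ((hi1.sub (by simp)).add (hi2.div_const 2)) hi3]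
      refine intervalIntegral.integral_congr fun x hx => ?_
      have h := hpt x hx
      rw [logDeriv_xiFun h.1 (by rw [h.2]; exact hT0.ne') (hne _ h.2)]
      push_cast
      ring
    have b1 : |(∫ x in (1 / 2 : ℝ)..2, 1 / (x + T * I : ℂ)).im| ≤ 3 / 2 := by
      refine (abs_im_le_norm _).trans ((intervalIntegral.norm_integral_le_of_norm_le_const
        (C := 1) fun x hx => ?_).trans (by norm_num))
      have h := (hpt x (uIoc_subset_uIcc hx)).2
      have h1 : 1 ≤ ‖(x + T * I : ℂ)‖ := by
        have := abs_im_le_norm (x + T * I : ℂ)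
        rw [h, abs_of_pos hT0] at this
        linarith
      rw [norm_div, norm_one]
      exact (div_le_one (by linarith)).mpr h1
    have b2 : |((∫ x in (1 / 2 : ℝ)..2, digamma ((x + T * I) / 2)) / 2).im| ≤
        Real.log T + 12 := by
      refine (abs_im_le_norm _).trans ?_
      rw [norm_div, norm_ofNat]
      have : ‖∫ x in (1 / 2 : ℝ)..2, digamma ((x + T * I) / 2)‖ ≤
          (Real.log T + 13) * |2 - 1 / 2| := by
        refine intervalIntegral.norm_integral_le_of_norm_le_const fun x hx => ?_
        have hx' := uIoc_subset_uIcc hx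
        have h := hpt x hx'
        rw [uIcc_of_le (by norm_num)] at hx'
        set w : ℂ := (x + T * I) / 2 with hw
        have hwre : 0 < w.re := by have := h.1; simpa [hw] using this
        have hwim : w.im = T / 2 := by simp [hw]
        have h1 := norm_digamma_sub_log_le hwre (by rw [hwim]; linarith)
        have h2 : 6 / w.im ≤ 8 := by
          rw [hwim, div_le_iff₀ (by linarith)]
          linarith
        have h3 : ‖log w‖ ≤ |Real.log ‖w‖| + |w.arg| := by
          have := norm_le_abs_re_add_abs_im (log w)
          rwa [log_re, log_im] at this
        have h4 : |w.arg| ≤ 3.15 := (abs_arg_le_pi w).trans (by linarith [Real.pi_lt_d2])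
        have hwl : 3 / 4 ≤ ‖w‖ := by
          have := abs_im_le_norm w
          rw [hwim, abs_of_pos (by linarith)] at this
          linarith
        have hwu : ‖w‖ ≤ 2 * T := by
          have := norm_le_abs_re_add_abs_im w
          rw [hwim, abs_of_pos hwre, abs_of_pos (by linarith)] at this
          have hre : w.re = x / 2 := by simp [hw]
          rw [hre] at this
          linarith [hx'.2]
        have h5 : |Real.log ‖w‖| ≤ Real.log T + 1 := by
          rw [abs_le]
          constructor
          · have := Real.one_sub_inv_le_log_of_pos (show 0 < ‖w‖ by linarith)
            have h6 : ‖w‖⁻¹ ≤ 4 / 3 := by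
              rw [inv_le_comm₀ (by linarith) (by norm_num)]
              linarith
            linarith
          · have := Real.log_le_log (by linarith) hwu
            rw [Real.log_mul (by norm_num) hT0.ne'] at this
            linarith [Real.log_two_lt_d9]
        have h6 : ‖digamma w‖ ≤ ‖digamma w - log w‖ + ‖log w‖ := by
          simpa using norm_add_le (digamma w - log w) (log w)
        linarith
      norm_num at this
      linarith
    have b3 : (∫ x in (1 / 2 : ℝ)..2, ((Real.log Real.pi / 2 : ℝ) : ℂ)).im = 0 := by
      rw [intervalIntegral.integral_const, real_smul, ← ofReal_mul, ofReal_im]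
    rw [hsplit, add_im, add_im, sub_im, b3, sub_zero]
    have b4 := abs_add_three (∫ x in (1 / 2 : ℝ)..2, 1 / (x + T * I : ℂ)).im
      ((∫ x in (1 / 2 : ℝ)..2, digamma ((x + T * I) / 2)) / 2).im
      (∫ x in (1 / 2 : ℝ)..2, logDeriv riemannZeta₁ (x + T * I)).im
    have b5 : C * (1 + Real.log (2 * (T + 5) ^ 3 / ‖riemannZeta₁ c‖)) ≤
        C * (30 * (1 + Real.log T)) := by
      gcongr
      linarith
    nlinarith
  · intro z hz
    have hz' : ‖z - c‖ ≤ 15 / 8 := by simpa [dist_eq_norm] using hz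
    have h1 := (abs_re_le_norm _).trans hz'
    rw [sub_re, hcre, abs_le] at h1
    have h2 : ‖c‖ ≤ 2 + T := by
      have := norm_le_abs_re_add_abs_im c
      rwa [hcre, hcim, abs_of_pos hT0, abs_of_pos (by norm_num)] at this
    have h3 : ‖z‖ ≤ ‖z - c‖ + ‖c‖ := by simpa using norm_add_le (z - c) c
    have h4 : 1 + ‖z‖ ≤ T + 5 := by linarith
    refine (norm_riemannZeta₁_le (by linarith)).trans ?_
    gcongr

/-- The main term in the Riemann–von Mangoldt formula. -/
noncomputable def zetaCountMain (x : ℝ) : ℝ :=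
  x / (2 * Real.pi) * (Real.log (x / (2 * Real.pi)) - 1)

theorem integral_log_one_add_half_mul_I (T : ℝ) :
    ∫ y in (1 : ℝ)..T, log (1 + (y / 2 : ℝ) * I) =
      -2 * I * (((1 + (T / 2 : ℝ) * I) * log (1 + (T / 2 : ℝ) * I) - (1 + (T / 2 : ℝ) * I)) -
        ((1 + (1 / 2 : ℝ) * I) * log (1 + (1 / 2 : ℝ) * I) - (1 + (1 / 2 : ℝ) * I))) := by
  have hs : ∀ y : ℝ, (1 + (y / 2 : ℝ) * I : ℂ) ∈ slitPlane := fun y => Or.inl (by simp)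
  have hd : ∀ y ∈ uIcc (1 : ℝ) T, HasDerivAt
      (fun y : ℝ => -2 * I * ((1 + (y / 2 : ℝ) * I) * log (1 + (y / 2 : ℝ) * I) -
        (1 + (y / 2 : ℝ) * I))) (log (1 + (y / 2 : ℝ) * I)) y := by
    intro y _
    have d : HasDerivAt (fun y : ℝ => (1 + (y / 2 : ℝ) * I : ℂ)) (1 / 2 * I) y := by
      have := (((HasDerivAt.ofReal_comp ((hasDerivAt_id y).div_const 2)).mul_const I).const_add
        (1 : ℂ))
      simpa using this
    have hne : (1 + (y / 2 : ℝ) * I : ℂ) ≠ 0 := slitPlane_ne_zero (hs y)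
    refine (((d.mul (d.clog_real (hs y))).sub d).const_mul (-2 * I)).congr_deriv ?_
    set w : ℂ := 1 + (y / 2 : ℝ) * I
    have e : w * (1 / 2 * I / w) = 1 / 2 * I := by field_simp
    rw [e]
    linear_combination (-log w) * I_sq
  rw [intervalIntegral.integral_eq_sub_of_hasDerivAt hd]
  · ring
  · refine Continuous.intervalIntegrable ?_ _ _
    exact Continuous.clog (by fun_prop) hs

theorem exists_abs_re_integral_log_sub_le :
    ∃ C : ℝ, ∀ T : ℝ, 3 / 2 ≤ T →
      |(∫ y in (1 : ℝ)..T, log (1 + (y / 2 : ℝ) * I)).re - (T * Real.log (T / 2) - T)| ≤ C := by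
  set K := (-2 * I * ((1 + (1 / 2 : ℝ) * I) * log (1 + (1 / 2 : ℝ) * I) -
    (1 + (1 / 2 : ℝ) * I))).re
  refine ⟨|K| + 12, fun T hT => ?_⟩
  have hT0 : 0 < T := by linarith
  set w : ℂ := 1 + (T / 2 : ℝ) * I with hw
  have hre : w.re = 1 := by simp [hw]
  have him : w.im = T / 2 := by simp [hw]
  -- The real part of `-2i(w log w - w)` is `T log|w| + 2 arg w - T`; replacing `|w|` by `T/2` then
  -- costs at most 2.
  have h1 : (∫ y in (1 : ℝ)..T, log (1 + (y / 2 : ℝ) * I)).re =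
      T * Real.log ‖w‖ + 2 * w.arg - T - K := by
    rw [integral_log_one_add_half_mul_I, mul_sub, sub_re]
    congr 1
    rw [mul_assoc, neg_mul, neg_re, show (2 : ℂ) = ((2 : ℝ) : ℂ) by simp, re_ofReal_mul, I_mul_re,
      sub_im, mul_im, log_re, log_im, hre, him]
    ring
  have hnT : T / 2 ≤ ‖w‖ := by
    have := abs_im_le_norm w
    rwa [him, abs_of_pos (by linarith)] at this
  have hnT' : ‖w‖ ≤ 1 + T / 2 := by
    have := norm_le_abs_re_add_abs_im w
    rwa [hre, him, abs_one, abs_of_pos (by linarith)] at this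
  have h2 : 0 ≤ Real.log ‖w‖ - Real.log (T / 2) :=
    sub_nonneg.mpr (Real.log_le_log (by linarith) hnT)
  have h3 : Real.log ‖w‖ - Real.log (T / 2) ≤ 2 / T := by
    rw [← Real.log_div (by linarith) (by linarith)]
    refine (Real.log_le_sub_one_of_pos (div_pos (by linarith) (by linarith))).trans ?_
    have : ‖w‖ / (T / 2) ≤ (1 + T / 2) / (T / 2) := by gcongr
    have e : (1 + T / 2) / (T / 2) = 1 + 2 / T := by field_simp; ring
    linarith
  have h4 : T * (Real.log ‖w‖ - Real.log (T / 2)) ≤ 2 := by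
    have := mul_le_mul_of_nonneg_left h3 hT0.le
    rwa [mul_div_cancel₀ _ hT0.ne'] at this
  have h5 : 0 ≤ T * (Real.log ‖w‖ - Real.log (T / 2)) := mul_nonneg hT0.le h2
  have h6 := abs_le.mp ((abs_arg_le_pi w).trans Real.pi_lt_d2.le)
  have h7 := abs_le.mp (le_refl |K|)
  rw [h1, abs_le]
  constructor <;> nlinarith [h6.1, h6.2, h7.1, h7.2]

/-- The contribution of the line `re s = 2` to the Riemann–von Mangoldt formula. -/
theorem exists_abs_re_integral_logDeriv_xiFun_le :
    ∃ C : ℝ, ∀ T : ℝ, 3 / 2 ≤ T →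
      |(∫ y in (1 : ℝ)..T, logDeriv xiFun (2 + y * I)).re - Real.pi * zetaCountMain T| ≤
        C * (1 + Real.log T) := by
  obtain ⟨C, hC⟩ := exists_abs_re_integral_log_sub_le
  refine ⟨|C| + 40, fun T hT => ?_⟩
  have hT0 : 0 < T := by linarith
  have hlogT : 0 ≤ Real.log T := Real.log_nonneg (by linarith)
  have hpt : ∀ y ∈ uIcc (1 : ℝ) T, 1 ≤ y := fun y hy => by
    rw [uIcc_of_le (by linarith)] at hy
    exact hy.1
  have him : ∀ y ∈ uIcc (1 : ℝ) T, (2 + y * I : ℂ).im ≠ 0 := fun y hy => by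
    have := hpt y hy
    simp
    linarith
  have hζre : ∀ y : ℝ, 1 / 3 ≤ (riemannZeta (2 + y * I)).re := fun y =>
    riemannZeta_re_pos_of_re_eq_two (by simp)
  have hζ : ∀ y : ℝ, riemannZeta (2 + y * I) ≠ 0 := fun y h => by
    have := hζre y
    rw [h] at this
    norm_num at this
  have hi1 : IntervalIntegrable (fun y : ℝ => ((2 : ℝ) + y * I - 0 : ℂ)⁻¹) volume 1 T := by
    refine ContinuousOn.intervalIntegrable (ContinuousOn.inv₀ (by fun_prop) ?_)
    exact fun y hy => ne_zero_of_im_ne_zero (by simpa using him y hy)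
  have hre2 : ∀ y : ℝ, 0 < (1 + (y / 2 : ℝ) * I : ℂ).re := fun y => by simp
  have hcd : Continuous fun y : ℝ => digamma (1 + (y / 2 : ℝ) * I) :=
    continuousOn_digamma.comp_continuous (by fun_prop) hre2
  have hi2 : IntervalIntegrable (fun y : ℝ => digamma (1 + (y / 2 : ℝ) * I)) volume 1 T :=
    hcd.intervalIntegrable _ _
  have hcl : Continuous fun y : ℝ => log (1 + (y / 2 : ℝ) * I) :=
    Continuous.clog (by fun_prop) fun y => Or.inl (hre2 y)
  have hζ1 : ∀ y : ℝ, riemannZeta₁ (2 + y * I) ≠ 0 := fun y => by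
    have h1 : (2 + y * I : ℂ) ≠ 1 := fun h => by
      have := congrArg re h
      simp at this
    rw [riemannZeta₁_eq_mul h1]
    exact mul_ne_zero (sub_ne_zero.mpr h1) (hζ y)
  have hc3 : Continuous fun y : ℝ => logDeriv riemannZeta₁ (2 + y * I) :=
    (continuousOn_logDeriv differentiable_riemannZeta₁).comp_continuous (by fun_prop) hζ1
  have hi3 := hc3.intervalIntegrable (μ := volume) 1 T
  have hsplit : ∫ y in (1 : ℝ)..T, logDeriv xiFun (2 + y * I) =
      (∫ y in (1 : ℝ)..T, ((2 : ℝ) + y * I - 0 : ℂ)⁻¹) -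
      (∫ y in (1 : ℝ)..T, ((Real.log Real.pi / 2 : ℝ) : ℂ)) +
      (∫ y in (1 : ℝ)..T, digamma (1 + (y / 2 : ℝ) * I)) / 2 +
      ∫ y in (1 : ℝ)..T, logDeriv riemannZeta₁ (2 + y * I) := by
    rw [← intervalIntegral.integral_div, ← intervalIntegral.integral_sub hi1 (by simp),
      ← intervalIntegral.integral_add (hi1.sub (by simp)) (hi2.div_const 2),
      ← intervalIntegral.integral_add ((hi1.sub (by simp)).add (hi2.div_const 2)) hi3]
    refine intervalIntegral.integral_congr fun y hy => ?_
    have e : (2 + y * I : ℂ) / 2 = 1 + (y / 2 : ℝ) * I := by push_cast; ring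
    rw [logDeriv_xiFun (by simp) (him y hy) (hζ y), e]
    simp
  have b1 : |(∫ y in (1 : ℝ)..T, ((2 : ℝ) + y * I - 0 : ℂ)⁻¹).re| ≤ 2 * Real.pi := by
    have := integral_vertical_inv_sub (a := 2) (p := 1) (q := T) (ρ := 0) (w := 1) one_ne_zero
      fun y _ => Or.inl (by simp)
    have h2 := congrArg im this
    rw [I_mul_im, sub_im, log_im, log_im] at h2
    rw [h2]
    refine (abs_sub _ _).trans ?_
    linarith [abs_arg_le_pi (1 * (((2 : ℝ) : ℂ) + T * I - 0)),
      abs_arg_le_pi (1 * (((2 : ℝ) : ℂ) + (1 : ℝ) * I - 0))]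
  have b2 : (∫ y in (1 : ℝ)..T, ((Real.log Real.pi / 2 : ℝ) : ℂ)).re =
      (T - 1) * (Real.log Real.pi / 2) := by
    rw [intervalIntegral.integral_const, real_smul, ← ofReal_mul, ofReal_re]
  -- On this line `log(s - 1) + log ζ(s)` is a genuine antiderivative, as both arguments of the
  -- logarithm have positive real part. The contribution is a sum of four principal arguments.
  have b3 : |(∫ y in (1 : ℝ)..T, logDeriv riemannZeta₁ (2 + y * I)).re| ≤ 4 * Real.pi := by
    have hd : ∀ y ∈ uIcc (1 : ℝ) T, HasDerivAt
        (fun y : ℝ => log (1 + y * I) + log (riemannZeta (2 + y * I)))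
        (I * logDeriv riemannZeta₁ (2 + y * I)) y := by
      intro y _
      have d1 : HasDerivAt (fun y : ℝ => (1 + y * I : ℂ)) I y := by
        simpa using ((HasDerivAt.ofReal_comp (hasDerivAt_id y)).mul_const I).const_add (1 : ℂ)
      have d2 : HasDerivAt (fun y : ℝ => (2 + y * I : ℂ)) I y := by
        simpa using ((HasDerivAt.ofReal_comp (hasDerivAt_id y)).mul_const I).const_add (2 : ℂ)
      have hs1 : (2 + y * I : ℂ) ≠ 1 := fun h => by
        have := congrArg re h
        simp at this
      have dz := (differentiableAt_riemannZeta hs1).hasDerivAt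
      have d3 : HasDerivAt (fun y : ℝ => riemannZeta (2 + y * I))
          (deriv riemannZeta (2 + y * I) * I) y := dz.comp y d2
      have e1 : riemannZeta₁ =ᶠ[𝓝 (2 + y * I : ℂ)] fun s => (s - 1) * riemannZeta s := by
        filter_upwards [isOpen_ne.mem_nhds hs1] with s hs
        exact riemannZeta₁_eq_mul hs
      have e2 : logDeriv riemannZeta₁ (2 + y * I) = 1 / (1 + y * I) +
          deriv riemannZeta (2 + y * I) / riemannZeta (2 + y * I) := by
        rw [logDeriv_apply, e1.deriv_eq, e1.self_of_nhds, ← logDeriv_apply,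
          logDeriv_mul (f := fun s => s - 1) _ (sub_ne_zero.mpr hs1) (hζ y) (by fun_prop)
            dz.differentiableAt, logDeriv_apply, logDeriv_apply]
        simp only [deriv_sub_const, deriv_id'']
        ring
      refine ((d1.clog_real (Or.inl (by simp))).add (d3.clog_real (Or.inl ?_))).congr_deriv ?_
      · linarith [hζre y]
      · rw [e2]
        ring
    have := intervalIntegral.integral_eq_sub_of_hasDerivAt hd (hi3.const_mul I)
    rw [intervalIntegral.integral_const_mul] at this
    have h2 := congrArg im this
    rw [I_mul_im, sub_im, add_im, add_im, log_im, log_im, log_im, log_im] at h2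
    rw [h2]
    have a1 := abs_le.mp (abs_arg_le_pi (1 + T * I))
    have a2 := abs_le.mp (abs_arg_le_pi (riemannZeta (2 + T * I)))
    have a3 := abs_le.mp (abs_arg_le_pi (1 + (1 : ℝ) * I))
    have a4 := abs_le.mp (abs_arg_le_pi (riemannZeta (2 + (1 : ℝ) * I)))
    rw [abs_le]
    constructor <;> linarith [a1.1, a1.2, a2.1, a2.2, a3.1, a3.2, a4.1, a4.2]
  have b4 : |(∫ y in (1 : ℝ)..T, digamma (1 + (y / 2 : ℝ) * I)).re -
      (∫ y in (1 : ℝ)..T, log (1 + (y / 2 : ℝ) * I)).re| ≤ 12 * Real.log T := by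
    rw [← sub_re, ← intervalIntegral.integral_sub hi2 (hcl.intervalIntegrable _ _)]
    refine (abs_re_le_norm _).trans ?_
    have hint : IntervalIntegrable (fun y : ℝ => 12 * y⁻¹) volume 1 T := by
      refine ContinuousOn.intervalIntegrable (continuousOn_const.mul (continuousOn_id.inv₀ ?_))
      intro y hy h
      have := hpt y hy
      rw [show y = 0 from h] at this
      norm_num at this
    refine (intervalIntegral.norm_integral_le_of_norm_le (by linarith)
      (g := fun y : ℝ => 12 * y⁻¹) (Eventually.of_forall fun y hy => ?_) hint).trans_eq ?_
    · have hy1 : 1 < y := hy.1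
      have hwim : (1 + (y / 2 : ℝ) * I : ℂ).im = y / 2 := by simp
      refine (norm_digamma_sub_log_le (hre2 y) (by rw [hwim]; linarith)).trans_eq ?_
      rw [hwim]
      field_simp
      norm_num
    · rw [intervalIntegral.integral_const_mul, integral_inv_of_pos one_pos hT0, div_one]
  have b5 := hC T hT
  have hM : Real.pi * zetaCountMain T =
      (T * Real.log (T / 2) - T) / 2 - T * (Real.log Real.pi / 2) := by
    have : Real.log (T / (2 * Real.pi)) = Real.log (T / 2) - Real.log Real.pi := by
      rw [← div_div, Real.log_div (by positivity) Real.pi_ne_zero]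
    rw [zetaCountMain, this]
    have := Real.pi_ne_zero
    field_simp
    ring
  have hπ1 : 0 ≤ Real.log Real.pi := Real.log_nonneg (by linarith [Real.pi_gt_three])
  have hπ2 : Real.log Real.pi ≤ 3 := by
    linarith [Real.log_le_sub_one_of_pos Real.pi_pos, Real.pi_lt_d2]
  have hπ3 := Real.pi_lt_d2
  rw [hsplit, add_re, add_re, sub_re, b2, hM,
    show ∀ z : ℂ, (z / 2).re = z.re / 2 from fun z => by simp]
  rw [abs_le] at b1 b3 b4 b5 ⊢
  have hCa := le_abs_self C
  have hC0 := abs_nonneg C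
  constructor <;> nlinarith [b1.1, b1.2, b3.1, b3.2, b4.1, b4.2, b5.1, b5.2]

/-- The Riemann–von Mangoldt formula at heights which are not ordinates of zeros. -/
theorem exists_abs_zetaCount_sub_le_of_ne :
    ∃ C : ℝ, 0 ≤ C ∧ ∀ T : ℝ, 3 / 2 ≤ T → (∀ z : ℂ, z.im = T → riemannZeta z ≠ 0) →
      |zetaCount T - zetaCountMain T| ≤ C * (1 + Real.log T) := by
  obtain ⟨C₁, h₁⟩ := exists_abs_im_integral_logDeriv_xiFun_le
  obtain ⟨C₂, h₂⟩ := exists_abs_re_integral_logDeriv_xiFun_le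
  set B := (∫ x in (-1 : ℝ)..2, logDeriv xiFun (x + (1 : ℝ) * I)).im
  refine ⟨|B| + |C₁| + |C₂|, by positivity, fun T hT hne => ?_⟩
  have hT0 : 0 < T := by linarith
  have hlogT : 0 ≤ Real.log T := Real.log_nonneg (by linarith)
  have hrect := rectIntegral_logDeriv_xiFun (by linarith) hne
  set R := ∫ y in (1 : ℝ)..T, logDeriv xiFun (2 + y * I) with hR
  set W := ∫ x in (1 / 2 : ℝ)..2, logDeriv xiFun (x + T * I) with hW
  -- By reflection the left side doubles the real part of `R`, and likewise the top edge doubles the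
  -- imaginary part of its right half `W`. The imaginary part of the contour integral becomes `B - 2
  -- im W + 2 re R`, to be equated with `2π N(T)`.
  have hleft : ∫ y in (1 : ℝ)..T, logDeriv xiFun ((-1 : ℝ) + y * I) = -conj R := by
    rw [hR, ← intervalIntegral.intervalIntegral_conj, ← intervalIntegral.integral_neg]
    refine intervalIntegral.integral_congr fun y hy => ?_
    rw [uIcc_of_le (by linarith)] at hy
    rw [← logDeriv_xiFun_one_sub_conj (by simp; linarith [hy.1])]
    congr 1
    apply Complex.ext
    · simp; norm_num
    · simp
  have hcont : Continuous fun x : ℝ => logDeriv xiFun (x + T * I) := by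
    refine (continuousOn_logDeriv differentiable_xiFun).comp_continuous (by fun_prop) fun x => ?_
    exact fun h => hne _ (by simp) ((xiFun_eq_zero_iff (by simp; exact hT0.ne')).mp h)
  have htop : ∫ x in (-1 : ℝ)..2, logDeriv xiFun (x + T * I) = W - conj W := by
    rw [← intervalIntegral.integral_add_adjacent_intervals (b := 1 / 2)
      (hcont.intervalIntegrable _ _) (hcont.intervalIntegrable _ _), ← hW]
    have h : ∫ x in (-1 : ℝ)..(1 / 2), logDeriv xiFun (x + T * I) = -conj W := by
      have e : ∫ x in (1 / 2 : ℝ)..2, logDeriv xiFun (((1 - x : ℝ) : ℂ) + T * I) =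
          ∫ x in (-1 : ℝ)..(1 / 2), logDeriv xiFun (x + T * I) := by
        rw [intervalIntegral.integral_comp_sub_left (fun x : ℝ => logDeriv xiFun (x + T * I)) 1]
        norm_num
      rw [← e, hW, ← intervalIntegral.intervalIntegral_conj, ← intervalIntegral.integral_neg]
      refine intervalIntegral.integral_congr fun x _ => ?_
      rw [← logDeriv_xiFun_one_sub_conj (by simp; exact hT0.ne')]
      congr 1
      simp
      ring
    rw [h]
    ring
  unfold rectIntegral at hrect
  rw [hleft, htop] at hrect
  have him := congrArg im hrect
  have hRe : (2 * Real.pi * I * (zetaCount T : ℂ)).im = 2 * Real.pi * zetaCount T := by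
    simp
  rw [hRe, sub_im, add_im, sub_im, sub_im, I_mul_im, I_mul_im, neg_re, conj_re, conj_im] at him
  have hB : (∫ x in (-1 : ℝ)..2, logDeriv xiFun (x + (1 : ℝ) * I)).im = B := rfl
  have hR' : (∫ y in (1 : ℝ)..T, logDeriv xiFun ((2 : ℝ) + y * I)).re = R.re := by simp [hR]
  rw [hB, hR'] at him
  have a1 := abs_le.mp (h₁ T hT hne)
  have a2 := abs_le.mp (h₂ T hT)
  have hu1 : C₁ * (1 + Real.log T) ≤ |C₁| * (1 + Real.log T) := by gcongr; exact le_abs_self _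
  have hu2 : C₂ * (1 + Real.log T) ≤ |C₂| * (1 + Real.log T) := by gcongr; exact le_abs_self _
  have hB1 := abs_le.mp (le_refl |B|)
  have hB2 : |B| ≤ |B| * (1 + Real.log T) := le_mul_of_one_le_right (abs_nonneg _) (by linarith)
  have key : |2 * Real.pi * (zetaCount T - zetaCountMain T)| ≤
      2 * ((|B| + |C₁| + |C₂|) * (1 + Real.log T)) := by
    rw [abs_le]
    constructor <;> nlinarith [a1.1, a1.2, a2.1, a2.2, hB1.1, hB1.2]
  rw [abs_mul, abs_of_pos (by positivity)] at key
  have h3 := Real.pi_gt_three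
  nlinarith [abs_nonneg (zetaCount T - zetaCountMain T)]

theorem hasDerivAt_zetaCountMain {x : ℝ} (hx : x ≠ 0) :
    HasDerivAt zetaCountMain (Real.log (x / (2 * Real.pi)) / (2 * Real.pi)) x := by
  have hπ := Real.pi_pos.ne'
  have d : HasDerivAt (fun x : ℝ => x / (2 * Real.pi)) (1 / (2 * Real.pi)) x :=
    (hasDerivAt_id x).div_const _
  have hne : x / (2 * Real.pi) ≠ 0 := by positivity
  refine (d.mul ((d.log hne).sub_const 1)).congr_deriv ?_
  field_simp
  ring

theorem abs_log_div_two_pi_le {x : ℝ} (hx : 1 ≤ x) :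
    |Real.log (x / (2 * Real.pi))| ≤ 2 + Real.log x := by
  have hx0 : 0 < x := by linarith
  have h1 : 0 ≤ Real.log (2 * Real.pi) := Real.log_nonneg (by linarith [Real.pi_gt_three])
  have h2 : Real.log (2 * Real.pi) ≤ 2 := by
    rw [Real.log_le_iff_le_exp (by positivity)]
    have h3 := Real.exp_one_gt_d9
    have : Real.exp 2 = Real.exp 1 ^ 2 := by rw [← Real.exp_nat_mul]; norm_num
    rw [this]
    nlinarith [Real.pi_lt_d2]
  rw [Real.log_div hx0.ne' (by positivity)]
  have := Real.log_nonneg hx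
  rw [abs_le]
  constructor <;> linarith

theorem zetaCount_nonneg (x : ℝ) : 0 ≤ zetaCount x :=
  Finset.sum_nonneg fun _ _ => Nat.cast_nonneg _

theorem zetaCount_mono : Monotone zetaCount := by
  intro x y hxy
  refine Finset.sum_le_sum_of_subset_of_nonneg (fun ρ hρ => ?_) fun _ _ _ => Nat.cast_nonneg _
  have h := (zetaZerosBelow_finite x).mem_toFinset.mp hρ
  exact (zetaZerosBelow_finite y).mem_toFinset.mpr ⟨h.1, h.2.1, h.2.2.trans_le hxy⟩

/-- The Riemann–von Mangoldt formula with error term `O(log x)`. -/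
theorem exists_abs_zetaCount_sub_le :
    ∃ C : ℝ, 0 ≤ C ∧ ∀ x : ℝ, 1 ≤ x →
      |zetaCount x - zetaCountMain x| ≤ C * (1 + Real.log x) := by
  obtain ⟨C, hC0, hC⟩ := exists_abs_zetaCount_sub_le_of_ne
  refine ⟨C + zetaCount 2 + 5, by linarith [zetaCount_nonneg 2], fun x hx => ?_⟩
  have hx0 : 0 < x := by linarith
  have hlog : 0 ≤ Real.log x := Real.log_nonneg hx
  have hN2 := zetaCount_nonneg 2
  rcases le_or_gt x 2 with h2 | h2
  · have h3 := zetaCount_mono h2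
    have h4 := zetaCount_nonneg x
    have h5 : |zetaCountMain x| ≤ 4 := by
      rw [zetaCountMain, abs_mul]
      have h6 : |x / (2 * Real.pi)| ≤ 1 := by
        rw [abs_of_pos (by positivity), div_le_one (by positivity)]
        linarith [Real.pi_gt_three]
      have h7 : |Real.log (x / (2 * Real.pi)) - 1| ≤ 4 := by
        have h8 := abs_log_div_two_pi_le hx
        have h9 : Real.log x ≤ 1 := by linarith [Real.log_le_sub_one_of_pos hx0]
        rw [abs_le] at h8 ⊢
        constructor <;> linarith [h8.1, h8.2]
      nlinarith [abs_nonneg (x / (2 * Real.pi)), abs_nonneg (Real.log (x / (2 * Real.pi)) - 1)]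
    rw [abs_le] at h5 ⊢
    constructor <;> nlinarith [h5.1, h5.2]
  -- If `x` is itself an ordinate, move to `T < x` above every ordinate below `x`. The strict
  -- inequality in the count makes `N(T) = N(x)`, and no zero has height exactly `T`.
  · obtain ⟨T, hT1, hT2, hTz⟩ : ∃ T, x - 1 / 2 < T ∧ T < x ∧
        ∀ z ∈ zetaZerosBelow x, z.im < T := by
      have hfin := (zetaZerosBelow_finite x).image im
      have hev : ∀ᶠ T in 𝓝[<] x, ∀ y ∈ im '' zetaZerosBelow x, y < T := by
        rw [Filter.eventually_all_finite hfin]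
        rintro _ ⟨z, hz, rfl⟩
        filter_upwards [Ioo_mem_nhdsLT hz.2.2] with T hT using hT.1
      have hev2 : ∀ᶠ T in 𝓝[<] x, T ∈ Ioo (x - 1 / 2) x := Ioo_mem_nhdsLT (by linarith)
      obtain ⟨T, h1, h2⟩ := (hev.and hev2).exists
      exact ⟨T, h2.1, h2.2, fun z hz => h1 _ ⟨z, hz, rfl⟩⟩
    have hT0 : 0 < T := by linarith
    have hNT : zetaCount x = zetaCount T := by
      unfold zetaCount
      congr 1
      ext z
      rw [(zetaZerosBelow_finite x).mem_toFinset, (zetaZerosBelow_finite T).mem_toFinset]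
      exact ⟨fun h => ⟨h.1, h.2.1, hTz z h⟩, fun h => ⟨h.1, h.2.1, h.2.2.trans hT2⟩⟩
    have h3 := hC T (by linarith) fun z hz h => by
      have := hTz z ⟨h, by rw [hz]; exact hT0, by rw [hz]; exact hT2⟩
      linarith
    have hlogT : Real.log T ≤ Real.log x := Real.log_le_log hT0 hT2.le
    have h4 : |zetaCountMain x - zetaCountMain T| ≤ 2 + Real.log x := by
      obtain ⟨ξ, hξ, hξe⟩ := exists_hasDerivAt_eq_slope zetaCountMain _ hT2
        (fun y hy => (hasDerivAt_zetaCountMain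
          (by linarith [hy.1])).continuousAt.continuousWithinAt)
        (fun y hy => hasDerivAt_zetaCountMain (by linarith [hy.1]))
      rw [eq_div_iff (by linarith)] at hξe
      have h5 := abs_log_div_two_pi_le (show 1 ≤ ξ by linarith [hξ.1])
      have h6 : Real.log ξ ≤ Real.log x := Real.log_le_log (by linarith [hξ.1]) hξ.2.le
      rw [← hξe, abs_mul, abs_div, abs_of_pos (show 0 < x - T by linarith),
        abs_of_pos (show 0 < 2 * Real.pi by positivity)]
      have h7 : |Real.log (ξ / (2 * Real.pi))| / (2 * Real.pi) ≤
          |Real.log (ξ / (2 * Real.pi))| :=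
        div_le_self (abs_nonneg _) (by linarith [Real.pi_gt_three])
      have h8 : 0 ≤ |Real.log (ξ / (2 * Real.pi))| / (2 * Real.pi) := by positivity
      nlinarith
    rw [hNT]
    have h5 : C * (1 + Real.log T) ≤ C * (1 + Real.log x) := by gcongr
    rw [abs_le] at h3 h4 ⊢
    constructor <;> nlinarith [h3.1, h3.2, h4.1, h4.2]

/-! ### Partial summation and the asymptotic formula -/

theorem norm_ofReal_cpow_neg_I_mul {u : ℝ} (hu : 0 < u) (τ : ℝ) :
    ‖(u : ℂ) ^ (-(I * (τ : ℂ)))‖ = 1 := by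
  rw [norm_cpow_eq_rpow_re_of_pos hu]
  simp

theorem hasDerivAt_ofReal_cpow_of_pos {u : ℝ} (hu : 0 < u) (c : ℂ) :
    HasDerivAt (fun u : ℝ => (u : ℂ) ^ c) (c * (u : ℂ) ^ (c - 1)) u := by
  have slit : (u : ℂ) ∈ slitPlane := by simpa using hu
  simpa using HasDerivAt.comp_ofReal (z := u) ((hasDerivAt_id (u : ℂ)).cpow_const (c := c) slit)

theorem intervalIntegrable_cpow_of_one_le {a b : ℝ} (ha : 0 < a) (hb : 0 < b) (c : ℂ) :
    IntervalIntegrable (fun u : ℝ => (u : ℂ) ^ c) volume a b := by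
  refine ContinuousOn.intervalIntegrable fun u hu => ?_
  have hu0 : 0 < u := (lt_min ha hb).trans_le hu.1
  exact (hasDerivAt_ofReal_cpow_of_pos hu0 c).continuousAt.continuousWithinAt

/-- Partial summation over the ordinates of the zeros. -/
theorem zetaOrdinateSum_eq {x : ℝ} (hx : 1 ≤ x) (τ : ℝ) :
    IntervalIntegrable (fun u : ℝ => -(I * τ) * (u : ℂ) ^ (-(I * (τ : ℂ)) - 1) * zetaCount u)
        volume 1 x ∧
      zetaOrdinateSum τ x = zetaCount x * (x : ℂ) ^ (-(I * (τ : ℂ))) -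
        ∫ u in (1 : ℝ)..x, -(I * τ) * (u : ℂ) ^ (-(I * (τ : ℂ)) - 1) * zetaCount u := by
  set f' : ℝ → ℂ := fun u => -(I * τ) * (u : ℂ) ^ (-(I * (τ : ℂ)) - 1) with hf'
  set Z := (zetaZerosBelow_finite x).toFinset with hZ
  set m := analyticOrderNatAt riemannZeta
  have hx0 : 0 < x := by linarith
  have hint : IntervalIntegrable f' volume 1 x :=
    (intervalIntegrable_cpow_of_one_le one_pos hx0 _).const_mul _
  have hcount : ∀ u ∈ uIoc 1 x, f' u * zetaCount u =
      ∑ ρ ∈ Z, (m ρ : ℂ) * (Ioi ρ.im).indicator f' u := by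
    intro u hu
    rw [uIoc_of_le hx] at hu
    have hsub : (zetaZerosBelow_finite u).toFinset ⊆ Z := fun ρ hρ => by
      have h := (zetaZerosBelow_finite u).mem_toFinset.mp hρ
      exact (zetaZerosBelow_finite x).mem_toFinset.mpr ⟨h.1, h.2.1, h.2.2.trans_le hu.2⟩
    rw [zetaCount, ofReal_sum, Finset.mul_sum]
    refine (Finset.sum_congr rfl fun ρ hρ => ?_).trans (Finset.sum_subset hsub fun ρ hρ hρ' => ?_)
    · have h := (zetaZerosBelow_finite u).mem_toFinset.mp hρ
      rw [indicator_of_mem (mem_Ioi.mpr h.2.2), ofReal_natCast, mul_comm]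
    · have h := (zetaZerosBelow_finite x).mem_toFinset.mp hρ
      rw [indicator_of_notMem, mul_zero]
      exact fun h' => hρ' ((zetaZerosBelow_finite u).mem_toFinset.mpr ⟨h.1, h.2.1, h'⟩)
  have hind : ∀ ρ : ℂ, IntervalIntegrable ((Ioi ρ.im).indicator f') volume 1 x := fun ρ => by
    rw [intervalIntegrable_iff] at hint ⊢
    exact hint.indicator measurableSet_Ioi
  have hsumint : IntervalIntegrable (fun u => ∑ ρ ∈ Z, (m ρ : ℂ) * (Ioi ρ.im).indicator f' u)
      volume 1 x := by
    have := IntervalIntegrable.sum Z (f := fun ρ u => (m ρ : ℂ) * (Ioi ρ.im).indicator f' u)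
      (fun ρ _ => (hind ρ).const_mul (m ρ : ℂ))
    simpa [Finset.sum_fn] using this
  refine ⟨hsumint.congr fun u hu => (hcount u hu).symm, ?_⟩
  -- Write `γ^{-iτ} = x^{-iτ} - ∫_γ^x f'`. Extending the integral down to 1 with an indicator is
  -- legitimate because every ordinate exceeds `3/2`.
  have hone : ∀ ρ ∈ Z, ((ρ.im : ℂ)) ^ (-(I * (τ : ℂ))) = (x : ℂ) ^ (-(I * (τ : ℂ))) -
      ∫ u in (1 : ℝ)..x, (Ioi ρ.im).indicator f' u := by
    intro ρ hρ
    obtain ⟨hz, h0, h1⟩ := (zetaZerosBelow_finite x).mem_toFinset.mp hρ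
    have hlow := three_halves_lt_im_of_riemannZeta_eq_zero h0 hz
    have e : ∫ u in (1 : ℝ)..x, (Ioi ρ.im).indicator f' u = ∫ u in ρ.im..x, f' u := by
      rw [intervalIntegral.integral_of_le hx, intervalIntegral.integral_of_le h1.le,
        setIntegral_indicator measurableSet_Ioi]
      congr 2
      ext u
      simp only [mem_inter_iff, mem_Ioc, mem_Ioi]
      constructor
      · rintro ⟨⟨_, h3⟩, h4⟩
        exact ⟨h4, h3⟩
      · rintro ⟨h3, h4⟩
        exact ⟨⟨by linarith, h4⟩, h3⟩
    rw [e, intervalIntegral.integral_eq_sub_of_hasDerivAt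
      (f := fun u : ℝ => (u : ℂ) ^ (-(I * (τ : ℂ)))) (fun u hu => ?_)
      ((intervalIntegrable_cpow_of_one_le h0 hx0 _).const_mul _)]
    · ring
    · exact hasDerivAt_ofReal_cpow_of_pos ((lt_min h0 hx0).trans_le hu.1) _
  have hI : ∫ u in (1 : ℝ)..x, f' u * zetaCount u =
      ∑ ρ ∈ Z, (m ρ : ℂ) * ∫ u in (1 : ℝ)..x, (Ioi ρ.im).indicator f' u := by
    simp_rw [← intervalIntegral.integral_const_mul]
    rw [← intervalIntegral.integral_finsetSum fun ρ _ => (hind ρ).const_mul _]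
    refine intervalIntegral.integral_congr_ae (Eventually.of_forall fun u hu => hcount u hu)
  rw [hI, zetaOrdinateSum, zetaCount, ofReal_sum, Finset.sum_mul, ← Finset.sum_sub_distrib]
  refine Finset.sum_congr rfl fun ρ hρ => ?_
  rw [hone ρ hρ, ofReal_natCast]
  ring

theorem one_sub_I_mul_ne_zero (τ : ℝ) : (1 - I * (τ : ℂ)) ≠ 0 := fun h => by
  have := congrArg re h
  simp at this

/-- The main term is an antiderivative of `u^{-iτ} M'(u)`, so the smooth part of the partial
summation integrates exactly. -/
theorem hasDerivAt_ordinateMainTerm {u : ℝ} (hu : 0 < u) (τ : ℝ) :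
    HasDerivAt (ordinateMainTerm τ) ((u : ℂ) ^ (-(I * (τ : ℂ))) / (2 * (Real.pi : ℂ)) *
      (Real.log (u / (2 * Real.pi)) : ℂ)) u := by
  have hne := one_sub_I_mul_ne_zero τ
  have hπ : (Real.pi : ℂ) ≠ 0 := by exact_mod_cast Real.pi_ne_zero
  have hu' : (u : ℂ) ≠ 0 := by exact_mod_cast hu.ne'
  have hv : u / (2 * Real.pi) ≠ 0 := by positivity
  have d1 := (hasDerivAt_ofReal_cpow_of_pos hu (1 - I * (τ : ℂ))).div_const
    (2 * (Real.pi : ℂ) * (1 - I * (τ : ℂ)))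
  have d2 : HasDerivAt (fun u : ℝ => (Real.log (u / (2 * Real.pi)) : ℂ)) ((1 / u : ℝ) : ℂ) u := by
    refine HasDerivAt.ofReal_comp ?_
    refine ((((hasDerivAt_id u).div_const (2 * Real.pi)).log hv)).congr_deriv ?_
    have := Real.pi_ne_zero
    simp only [id]
    field_simp
  refine (d1.mul (d2.sub_const (1 / (1 - I * (τ : ℂ))))).congr_deriv ?_
  have e1 : (u : ℂ) ^ (1 - I * (τ : ℂ) - 1) = (u : ℂ) ^ (-(I * (τ : ℂ))) := by ring_nf
  have e2 : (u : ℂ) ^ (1 - I * (τ : ℂ)) = u * (u : ℂ) ^ (-(I * (τ : ℂ))) := by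
    rw [sub_eq_add_neg, cpow_add _ _ hu', cpow_one]
  rw [e1, e2]
  push_cast
  field_simp
  ring

/-- Follows from `v |log v| < 1` at `v = x/2π ≤ 1`. The factor `1/|1 - iτ|` is kept because the
bound for `|τ log x| ≥ δ` needs decay in `τ` when `x` is small. -/
theorem norm_ordinateMainTerm_le {x : ℝ} (hx : 0 < x) (hx2 : x ≤ 2) (τ : ℝ) :
    ‖ordinateMainTerm τ x‖ ≤ 2 / ‖1 - I * (τ : ℂ)‖ := by
  have hpos : 0 < ‖1 - I * (τ : ℂ)‖ := norm_pos_iff.mpr (one_sub_I_mul_ne_zero τ)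
  have h1 : 1 ≤ ‖1 - I * (τ : ℂ)‖ := by
    have := abs_re_le_norm (1 - I * (τ : ℂ))
    simpa using this
  have hv : 0 < x / (2 * Real.pi) := by positivity
  have hv1 : x / (2 * Real.pi) ≤ 1 := by
    rw [div_le_one (by positivity)]
    linarith [Real.pi_gt_three]
  have h2 := (Real.abs_log_mul_self_lt _ hv hv1).le
  rw [abs_mul, abs_of_pos hv] at h2
  have h3 : ‖(Real.log (x / (2 * Real.pi)) : ℂ) - 1 / (1 - I * (τ : ℂ))‖ ≤
      |Real.log (x / (2 * Real.pi))| + 1 := by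
    refine (norm_sub_le _ _).trans (add_le_add (by rw [norm_real, Real.norm_eq_abs]) ?_)
    rw [norm_div, norm_one]
    exact (div_le_one hpos).mpr h1
  rw [ordinateMainTerm, norm_mul, norm_div, norm_mul, norm_mul, norm_ofNat, norm_real,
    Real.norm_of_nonneg Real.pi_pos.le, norm_cpow_eq_rpow_re_of_pos hx]
  have h4 : (1 - I * (τ : ℂ)).re = 1 := by simp
  rw [h4, Real.rpow_one, ← div_div, div_mul_eq_mul_div]
  gcongr
  calc x / (2 * Real.pi) * ‖(Real.log (x / (2 * Real.pi)) : ℂ) - 1 / (1 - I * (τ : ℂ))‖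
      ≤ x / (2 * Real.pi) * (|Real.log (x / (2 * Real.pi))| + 1) := by gcongr
    _ ≤ 2 := by linarith

theorem zetaOrdinateSum_eq_zero {x : ℝ} (hx : x ≤ 3 / 2) (τ : ℝ) : zetaOrdinateSum τ x = 0 := by
  refine Finset.sum_eq_zero fun ρ hρ => ?_
  obtain ⟨hz, h0, h1⟩ := (zetaZerosBelow_finite x).mem_toFinset.mp hρ
  linarith [three_halves_lt_im_of_riemannZeta_eq_zero h0 hz]

theorem norm_zetaOrdinateSum_sub_le_of_le {x : ℝ} (hx : 0 < x) (hx2 : x ≤ 3 / 2) (τ : ℝ) :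
    ‖zetaOrdinateSum τ x - ordinateMainTerm τ x‖ ≤ 2 / ‖1 - I * (τ : ℂ)‖ := by
  rw [zetaOrdinateSum_eq_zero hx2, zero_sub, norm_neg]
  exact norm_ordinateMainTerm_le hx (by linarith) τ

/-- The asymptotic formula for the exponential sum over ordinates, by partial summation. -/
theorem exists_norm_zetaOrdinateSum_sub_le :
    ∃ C : ℝ, 0 ≤ C ∧ ∀ τ x : ℝ, 3 / 2 ≤ x → ‖zetaOrdinateSum τ x - ordinateMainTerm τ x‖ ≤
      C * (1 + Real.log x + |τ| * Real.log x ^ 2) := by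
  obtain ⟨C, hC0, hC⟩ := exists_abs_zetaCount_sub_le
  refine ⟨4 * C + |zetaCountMain 1| + 2, by positivity, fun τ x hx => ?_⟩
  have hx0 : 0 < x := by linarith
  have hx1 : 1 ≤ x := by linarith
  have hlog : 1 / 3 ≤ Real.log x := by
    refine le_trans ?_ (Real.one_sub_inv_le_log_of_pos hx0)
    have : x⁻¹ ≤ 2 / 3 := by
      rw [inv_le_comm₀ hx0 (by norm_num)]
      linarith
    linarith
  set f' : ℝ → ℂ := fun u => -(I * τ) * (u : ℂ) ^ (-(I * (τ : ℂ)) - 1) with hf'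
  obtain ⟨hNint, hsum⟩ := zetaOrdinateSum_eq hx1 τ
  have hpos : ∀ u ∈ uIcc 1 x, 0 < u := fun u hu => (lt_min one_pos hx0).trans_le hu.1
  -- The product rule for `u^{-iτ} M(u)`, minus the main term, leaves exactly `f' M`. Subtracting
  -- its integral replaces `N` by `N - M` everywhere.
  have hd : ∀ u ∈ uIcc 1 x, HasDerivAt (fun u : ℝ => (u : ℂ) ^ (-(I * (τ : ℂ))) *
      zetaCountMain u - ordinateMainTerm τ u) (f' u * zetaCountMain u) u := by
    intro u hu
    have hu0 := hpos u hu
    refine (((hasDerivAt_ofReal_cpow_of_pos hu0 (-(I * (τ : ℂ)))).mul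
      (hasDerivAt_zetaCountMain hu0.ne').ofReal_comp).sub
      (hasDerivAt_ordinateMainTerm hu0 τ)).congr_deriv ?_
    simp only [hf']
    push_cast
    ring
  have hMint : IntervalIntegrable (fun u => f' u * zetaCountMain u) volume 1 x := by
    refine ((intervalIntegrable_cpow_of_one_le one_pos hx0 _).const_mul _).mul_continuousOn ?_
    exact fun u hu => (hasDerivAt_zetaCountMain
      (hpos u hu).ne').ofReal_comp.continuousAt.continuousWithinAt
  have hftc := intervalIntegral.integral_eq_sub_of_hasDerivAt hd hMint
  have key : zetaOrdinateSum τ x - ordinateMainTerm τ x =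
      ((zetaCount x - zetaCountMain x : ℝ) : ℂ) * (x : ℂ) ^ (-(I * (τ : ℂ))) -
        (∫ u in (1 : ℝ)..x, f' u * ((zetaCount u - zetaCountMain u : ℝ) : ℂ)) +
        (zetaCountMain 1 - ordinateMainTerm τ 1) := by
    have e : ∫ u in (1 : ℝ)..x, f' u * ((zetaCount u - zetaCountMain u : ℝ) : ℂ) =
        (∫ u in (1 : ℝ)..x, f' u * zetaCount u) - ∫ u in (1 : ℝ)..x, f' u * zetaCountMain u := by
      rw [← intervalIntegral.integral_sub hNint hMint]
      congr 1
      ext u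
      push_cast
      ring
    rw [e, hftc, hsum]
    push_cast
    rw [one_cpow]
    ring
  have b1 : ‖((zetaCount x - zetaCountMain x : ℝ) : ℂ) * (x : ℂ) ^ (-(I * (τ : ℂ)))‖ ≤
      C * (1 + Real.log x) := by
    rw [norm_mul, norm_ofReal_cpow_neg_I_mul hx0, mul_one, norm_real]
    exact hC x hx1
  have b2 : ‖∫ u in (1 : ℝ)..x, f' u * ((zetaCount u - zetaCountMain u : ℝ) : ℂ)‖ ≤
      |τ| * (C * (1 + Real.log x)) * Real.log x := by
    have hint : IntervalIntegrable (fun u : ℝ => |τ| * (C * (1 + Real.log x)) * u⁻¹) volume 1 x :=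
      ContinuousOn.intervalIntegrable (continuousOn_const.mul
        (continuousOn_id.inv₀ fun u hu => (hpos u hu).ne'))
    refine (intervalIntegral.norm_integral_le_of_norm_le hx1
      (g := fun u : ℝ => |τ| * (C * (1 + Real.log x)) * u⁻¹)
      (Eventually.of_forall fun u hu => ?_) hint).trans_eq ?_
    · have hu0 : 0 < u := one_pos.trans hu.1
      have h1 : ‖f' u‖ = |τ| * u⁻¹ := by
        simp only [hf']
        rw [norm_mul, norm_neg, norm_mul, norm_I, one_mul, norm_real, Real.norm_eq_abs,
          norm_cpow_eq_rpow_re_of_pos hu0]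
        simp [Real.rpow_neg_one]
      rw [norm_mul, h1, norm_real, Real.norm_eq_abs]
      have h2 := hC u hu.1.le
      have h3 : Real.log u ≤ Real.log x := Real.log_le_log hu0 hu.2
      calc |τ| * u⁻¹ * |zetaCount u - zetaCountMain u|
          ≤ |τ| * u⁻¹ * (C * (1 + Real.log x)) := by
            refine mul_le_mul_of_nonneg_left (h2.trans ?_) (by positivity)
            gcongr
        _ = _ := by ring
    · rw [intervalIntegral.integral_const_mul, integral_inv_of_pos one_pos hx0, div_one]
  have b3 : ‖(zetaCountMain 1 : ℂ) - ordinateMainTerm τ 1‖ ≤ |zetaCountMain 1| + 2 := by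
    refine (norm_sub_le _ _).trans (add_le_add (by rw [norm_real, Real.norm_eq_abs]) ?_)
    refine (norm_ordinateMainTerm_le one_pos one_le_two τ).trans ?_
    have h1 : 1 ≤ ‖1 - I * (τ : ℂ)‖ := by
      have := abs_re_le_norm (1 - I * (τ : ℂ))
      simpa using this
    exact div_le_self (by norm_num) h1
  rw [key]
  have b4 : |τ| * (C * (1 + Real.log x)) * Real.log x ≤ 4 * C * (|τ| * Real.log x ^ 2) := by
    -- The lower bound `log x ≥ 1/3` gives `1 + log x ≤ 4 log x`.
    have h1 : (1 + Real.log x) * Real.log x ≤ 4 * Real.log x ^ 2 := by nlinarith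
    have h2 : 0 ≤ |τ| * C := by positivity
    nlinarith
  have hτ : 0 ≤ |τ| * Real.log x ^ 2 := by positivity
  have hM := abs_nonneg (zetaCountMain 1)
  calc _ ≤ C * (1 + Real.log x) + |τ| * (C * (1 + Real.log x)) * Real.log x +
        (|zetaCountMain 1| + 2) :=
        (norm_add_le _ _).trans (add_le_add ((norm_sub_le _ _).trans (add_le_add b1 b2)) b3)
    _ ≤ _ := by
      have h1 : 0 ≤ C * (1 + Real.log x) := by positivity
      have h2 : 0 ≤ (|zetaCountMain 1| + 2) * (Real.log x + |τ| * Real.log x ^ 2) := by positivity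
      linarith

/-! ### The Lindelöf range and the final statement -/

theorem ordinateIntegral_eq {x : ℝ} (hx : 2 ≤ x) (τ : ℝ) :
    ordinateIntegral τ x = ordinateMainTerm τ x - ordinateMainTerm τ 2 := by
  have hpos : ∀ u ∈ uIcc 2 x, 0 < u := fun u hu =>
    (lt_min two_pos (by linarith : 0 < x)).trans_le hu.1
  refine intervalIntegral.integral_eq_sub_of_hasDerivAt
    (fun u hu => hasDerivAt_ordinateMainTerm (hpos u hu) τ) ?_
  refine ContinuousOn.intervalIntegrable fun u hu => ContinuousAt.continuousWithinAt ?_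
  have hu0 := hpos u hu
  have h1 := (hasDerivAt_ofReal_cpow_of_pos hu0 (-(I * (τ : ℂ)))).continuousAt
  have hv : u / (2 * Real.pi) ≠ 0 := by positivity
  have h2 : ContinuousAt (fun u : ℝ => Real.log (u / (2 * Real.pi))) u :=
    (continuousAt_id.div_const _).log hv
  exact (h1.div_const _).mul (continuous_ofReal.continuousAt.comp h2)

/-- Write `|τ| = |τ|^ε (|τ|^2)^{(1-ε)/2} ≤ |τ|^ε x^{(1-ε)/2}`; the missing `x^{ε/2}` absorbs `(log
x)^2`. The condition `ε ≤ 1` keeps the exponent nonnegative. -/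
theorem log_sq_mul_abs_le {ε τ x : ℝ} (hε : 0 < ε) (hε1 : ε ≤ 1) (hτ : 1 < |τ|) (hx : 1 ≤ x)
    (h : |τ| ^ 2 ≤ x) :
    |τ| * Real.log x ^ 2 ≤ 16 / ε ^ 2 * (|τ| ^ ε * x ^ (1 / 2 : ℝ)) := by
  have hτ0 : 0 < |τ| := by linarith
  have hx0 : 0 < x := by linarith
  have h1 : |τ| = |τ| ^ ε * (|τ| ^ 2) ^ ((1 - ε) / 2) := by
    rw [← Real.rpow_natCast, ← Real.rpow_mul hτ0.le, ← Real.rpow_add hτ0]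
    conv_lhs => rw [← Real.rpow_one |τ|]
    congr 1
    push_cast
    ring
  have h2 : (|τ| ^ 2) ^ ((1 - ε) / 2) ≤ x ^ ((1 - ε) / 2) :=
    Real.rpow_le_rpow (by positivity) h (by linarith)
  have h3 : Real.log x ≤ x ^ (ε / 4) / (ε / 4) := Real.log_le_rpow_div hx0.le (by linarith)
  have h4 : Real.log x ^ 2 ≤ 16 / ε ^ 2 * x ^ (ε / 2) := by
    have h5 : Real.log x ^ 2 ≤ (x ^ (ε / 4) / (ε / 4)) ^ 2 :=
      pow_le_pow_left₀ (Real.log_nonneg hx) h3 2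
    refine h5.trans_eq ?_
    have h6 : x ^ (ε / 2) = (x ^ (ε / 4)) ^ 2 := by
      rw [← Real.rpow_natCast, ← Real.rpow_mul hx0.le]
      congr 1
      push_cast
      ring
    rw [h6]
    field_simp
    norm_num
  calc |τ| * Real.log x ^ 2
      = |τ| ^ ε * (|τ| ^ 2) ^ ((1 - ε) / 2) * Real.log x ^ 2 := by rw [← h1]
    _ ≤ |τ| ^ ε * x ^ ((1 - ε) / 2) * (16 / ε ^ 2 * x ^ (ε / 2)) := by gcongr
    _ = 16 / ε ^ 2 * (|τ| ^ ε * (x ^ ((1 - ε) / 2) * x ^ (ε / 2))) := by ring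
    _ = _ := by
      rw [← Real.rpow_add hx0]
      ring_nf

theorem theorem1 :
    -- the asymptotic formula for all real `τ` and all `x > 0`
    (∃ C : ℝ, ∀ τ x : ℝ, 0 < x →
      ‖zetaOrdinateSum τ x - ordinateMainTerm τ x‖
        ≤ C * (1 + |Real.log x| + |τ| * Real.log x ^ 2)) ∧
    -- the error is `O(|τ| (log x)^2)` as soon as `|τ log x|` is bounded away from zero
    (∀ δ : ℝ, 0 < δ → ∃ C : ℝ, ∀ τ x : ℝ, 0 < x → δ ≤ |τ * Real.log x| →
      ‖zetaOrdinateSum τ x - ordinateMainTerm τ x‖ ≤ C * (|τ| * Real.log x ^ 2)) ∧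
    -- the Lindelöf Hypothesis for the ordinates in the range `|τ|^2 ≤ x ≤ |τ|^B`
    (∀ ε : ℝ, 0 < ε → ∃ C : ℝ, ∀ B : ℝ, 0 < B → ∀ τ x : ℝ,
      2 ≤ x → |τ| ^ 2 ≤ x → x ≤ |τ| ^ B →
        ‖zetaOrdinateSum τ x - ordinateIntegral τ x‖ ≤ C * (|τ| ^ ε * x ^ (1 / 2 : ℝ))) := by
  obtain ⟨C, hC0, hC⟩ := exists_norm_zetaOrdinateSum_sub_le
  have hlow : ∀ x : ℝ, 3 / 2 ≤ x → 1 / 3 ≤ Real.log x := fun x hx => by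
    have hx0 : 0 < x := by linarith
    refine le_trans ?_ (Real.one_sub_inv_le_log_of_pos hx0)
    have : x⁻¹ ≤ 2 / 3 := by
      rw [inv_le_comm₀ hx0 (by norm_num)]
      linarith
    linarith
  have hone : ∀ τ : ℝ, 1 ≤ ‖1 - Complex.I * (τ : ℂ)‖ := fun τ => by
    simpa using Complex.abs_re_le_norm (1 - Complex.I * (τ : ℂ))
  have htau : ∀ τ : ℝ, |τ| ≤ ‖1 - Complex.I * (τ : ℂ)‖ := fun τ => by
    simpa using Complex.abs_im_le_norm (1 - Complex.I * (τ : ℂ))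
  refine ⟨⟨C + 2, fun τ x hx => ?_⟩, fun δ hδ => ⟨2 / δ ^ 2 + C * (4 / δ + 1), fun τ x hx h => ?_⟩,
    fun ε hε => ⟨(16 * C + 18) * (16 / (min ε 1) ^ 2), fun B hB τ x hx h1 h2 => ?_⟩⟩
  · have hnn : 0 ≤ |Real.log x| + |τ| * Real.log x ^ 2 := by positivity
    rcases le_total x (3 / 2) with h | h
    · refine (norm_zetaOrdinateSum_sub_le_of_le hx h τ).trans
        ((div_le_self (by norm_num) (hone τ)).trans ?_)
      nlinarith
    · refine (hC τ x h).trans ?_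
      have hl : |Real.log x| = Real.log x := abs_of_nonneg (by linarith [hlow x h])
      rw [hl] at hnn ⊢
      exact mul_le_mul_of_nonneg_right (by linarith) (by linarith)
  · rw [abs_mul] at h
    have hnn : 0 ≤ |τ| * Real.log x ^ 2 := by positivity
    have hτ : 0 < |τ| := (abs_nonneg τ).lt_of_ne fun h0 => by rw [← h0, zero_mul] at h; linarith
    rcases le_total x (3 / 2) with hx2 | hx2
    · refine (norm_zetaOrdinateSum_sub_le_of_le hx hx2 τ).trans ?_
      have h3 : 2 / ‖1 - Complex.I * (τ : ℂ)‖ ≤ 2 / |τ| := by gcongr; exact htau τ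
      -- Squaring `δ ≤ |τ| |log x|` and dividing by `|τ|` bounds `1/|τ|` by `|τ| (log x)^2 / δ^2`.
      have h4 : 2 / |τ| ≤ 2 / δ ^ 2 * (|τ| * Real.log x ^ 2) := by
        rw [div_mul_eq_mul_div, div_le_div_iff₀ hτ (by positivity)]
        have : δ ^ 2 ≤ (|τ| * |Real.log x|) ^ 2 := pow_le_pow_left₀ hδ.le h 2
        rw [mul_pow, sq_abs (Real.log x)] at this
        nlinarith
      have h5 : 0 ≤ C * (4 / δ + 1) * (|τ| * Real.log x ^ 2) := by positivity
      linarith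
    · have hl := hlow x hx2
      refine (hC τ x hx2).trans ?_
      rw [abs_of_nonneg (show 0 ≤ Real.log x by linarith)] at h
      have h3 : 1 + Real.log x ≤ 4 / δ * (|τ| * Real.log x ^ 2) := by
        rw [div_mul_eq_mul_div, le_div_iff₀ hδ]
        nlinarith [mul_le_mul_of_nonneg_right h (show 0 ≤ Real.log x by linarith)]
      have h4 : 0 ≤ 2 / δ ^ 2 * (|τ| * Real.log x ^ 2) := by positivity
      calc C * (1 + Real.log x + |τ| * Real.log x ^ 2)
          ≤ C * (4 / δ * (|τ| * Real.log x ^ 2) + |τ| * Real.log x ^ 2) := by gcongr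
        _ ≤ _ := by linarith
  -- The upper limit `x ≤ |τ|^B` serves only to force `|τ| > 1`, since `x ≥ 2` and `B > 0`. Hence
  -- the constant does not depend on `B`.
  · have hτ : 1 < |τ| := by
      by_contra hle
      linarith [Real.rpow_le_one (abs_nonneg τ) (not_lt.mp hle) hB.le]
    have hx0 : 0 < x := by linarith
    have hl := hlow x (by linarith)
    set ε' := min ε 1
    have hε' : 0 < ε' := lt_min hε one_pos
    have h3 := log_sq_mul_abs_le hε' (min_le_right _ _) hτ (by linarith) h1
    have h4 : |τ| ^ ε' ≤ |τ| ^ ε := Real.rpow_le_rpow_of_exponent_le hτ.le (min_le_left _ _)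
    have h5 : ‖ordinateMainTerm τ 2‖ ≤ 2 :=
      (norm_ordinateMainTerm_le two_pos le_rfl τ).trans (div_le_self (by norm_num) (hone τ))
    have h6 : ‖zetaOrdinateSum τ x - ordinateIntegral τ x‖ ≤
        C * (1 + Real.log x + |τ| * Real.log x ^ 2) + 2 := by
      rw [ordinateIntegral_eq hx, show zetaOrdinateSum τ x -
        (ordinateMainTerm τ x - ordinateMainTerm τ 2) =
        (zetaOrdinateSum τ x - ordinateMainTerm τ x) + ordinateMainTerm τ 2 by ring]
      exact (norm_add_le _ _).trans (add_le_add (hC τ x (by linarith)) h5)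
    have h7 : Real.log x ^ 2 ≤ |τ| * Real.log x ^ 2 :=
      le_mul_of_one_le_left (sq_nonneg _) hτ.le
    -- Since `log x ≥ 1/3`, the three terms in the parenthesis are at most 9, 3 and 1 times `|τ|
    -- (log x)^2`, within 16; the extra 2 from the lower limit of integration is at most 18 times
    -- it.
    have h8 : 1 ≤ 9 * Real.log x ^ 2 := by nlinarith
    have h9 : Real.log x ≤ 3 * Real.log x ^ 2 := by nlinarith
    calc _ ≤ C * (1 + Real.log x + |τ| * Real.log x ^ 2) + 2 := h6
      _ ≤ C * (16 * (|τ| * Real.log x ^ 2)) + 18 * (|τ| * Real.log x ^ 2) := by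
        gcongr
        · linarith
        · linarith
      _ = (16 * C + 18) * (|τ| * Real.log x ^ 2) := by ring
      _ ≤ (16 * C + 18) * (16 / ε' ^ 2 * (|τ| ^ ε * x ^ (1 / 2 : ℝ))) := by
        refine mul_le_mul_of_nonneg_left (h3.trans ?_) (by positivity)
        gcongr
      _ = _ := by ring
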